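/- Let $n\ge 2$ and write a permutation $\pi$ of $\{1,\dots,n\}$ as the sequence $\pi(1),\dots,\pi(n)$. A *placement* takes a number $v$ with $\pi^{-1}(v)\ne v$ and moves it to position $v$; a *displacement* takes a number $v$ with $\pi^{-1}(v)=v$ and moves it to some position $t\neq v$. In both cases the entries between the old and the new position of $v$ are shifted by one place. The *height* of $\pi$ is the maximum length of a sequence of placements leading from $\pi$ to the identity, and $M_n$ is the set of permutations of $\{1,\dots,n\}$ of height $2^{n-1}-1$ (the worst-case starting points for homing). Let $\tau_n$ be the permutation $n,2,3,\dots,n-1,1$. The *code* of $\pi$ is the word $a_2a_3\cdots a_{n-1}$ with $a_v=+$, $0$ or $-$ according as $\pi^{-1}(v)>v$, $\pi^{-1}(v)=v$ or $\pi^{-1}(v)<v$. Write $(v\to t)$ for the displacement of $v$ into position $t$. For a position $p$ define the sequences of displacements $A_{p,1}=\emptyset$, $A_{p,k+1}=A_{p,k},\,(p+k\to p),\,A_{p,k}$ and $B_{p,1}=\emptyset$, $B_{p,k+1}=B_{p,k},\,(p-k\to p),\,B_{p,k}$. Let $\pi$ have code $+^i0^k-^j$ with $k\ge1$ (and $i,j\ge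 0$, $i+k+j=n-2$). A *left firing* on $\pi$ consists of the $2^{k-1}$ displacements $A_{i+1,k},\,(i+k+1\to s)$, performed in this order, for some position $s\le i+1$. A *right firing* on $\pi$ consists of the $2^{k-1}$ displacements $B_{i+k+2,k},\,(i+2\to s)$, performed in this order, for some position $s$ with $i+k+2\le s\le n$. **Lemma.** A permutation $\sigma$ of $\{1,\dots,n\}$ belongs to $M_n$ if and only if it can be obtained from $\tau_n$ by successively applying $n-2$ firings, each of which is a left or a right firing. -/

import Mathlib

/-!
A permutation `π` of `{1, …, n}`, written as the sequence `π(1), …, π(n)`, is modelled by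
`π : Equiv.Perm (Fin n)`: positions and values are both counted from `0`, and `π q` is the value in
position `q` (so `π.symm v` is the position of the value `v`). The number `m` of `{1, …, n}`
corresponds to the index `m - 1`.
-/

namespace Homing

/-- `moveTo π v t` is obtained from the sequence `π` by moving the value `v` to position `t` and
shifting by one place all entries between its old position and `t`. (`Fin.cycleIcc a b`, for
`a ≤ b`, sends `a ↦ a + 1 ↦ ⋯ ↦ b ↦ a` and fixes everything outside `[a, b]`.) -/
def moveTo {n : ℕ} (π : Equiv.Perm (Fin n)) (v t : Fin n) : Equiv.Perm (Fin n) :=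
  if π.symm v ≤ t then π * Fin.cycleIcc (π.symm v) t
  else π * (Fin.cycleIcc t (π.symm v))⁻¹

/-- One step of homing: some value `v` that is not at home is placed into its home position. -/
def Placement {n : ℕ} (π π' : Equiv.Perm (Fin n)) : Prop :=
  ∃ v : Fin n, π.symm v ≠ v ∧ π' = moveTo π v v

/-- A displacement (the reverse of a placement): the value `v`, which is at home, is moved to
another position `t`. -/
def Displacement {n : ℕ} (v t : Fin n) (π π' : Equiv.Perm (Fin n)) : Prop :=
  π.symm v = v ∧ t ≠ v ∧ π' = moveTo π v t

/-- `Steps R m a b`: `b` is obtained from `a` by exactly `m` successive steps of the relation `R`. -/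
def Steps {α : Type*} (R : α → α → Prop) : ℕ → α → α → Prop
  | 0, a, b => a = b
  | m + 1, a, b => ∃ c, R a c ∧ Steps R m c b

/-- The height of `π` is `h`: the maximum length of a sequence of placements that
leads from `π` to the identity exists and equals `h`. -/
def HasHeight {n : ℕ} (π : Equiv.Perm (Fin n)) (h : ℕ) : Prop :=
  IsGreatest {m : ℕ | Steps Placement m π 1} h

/-- The set `M_n` of permutations of height `2 ^ (n - 1) - 1`, the worst-case starting points for
homing. -/
def M (n : ℕ) : Set (Equiv.Perm (Fin n)) :=
  {π | HasHeight π (2 ^ (n - 1) - 1)}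

/-- The permutation `τ_n = n, 2, 3, …, n - 1, 1`. -/
def tau (n : ℕ) (hn : 2 ≤ n) : Equiv.Perm (Fin n) :=
  Equiv.swap ⟨0, by omega⟩ ⟨n - 1, by omega⟩

/-- The code of `π`, a word of length `n - 2` in the letters `+ = 1`, `- = -1` and `0`: there is one
letter for each value other than the smallest and the largest one. The letter of a value is `+` if
the value is to the right of its home, `-` if it is to the left of its home, `0` if it is at home. -/
def code {n : ℕ} (π : Equiv.Perm (Fin n)) (m : Fin (n - 2)) : SignType :=
  have hm : m.val + 1 < n := by have := m.isLt; omega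
  if m.val + 1 < (π.symm ⟨m.val + 1, hm⟩).val then 1
  else if (π.symm ⟨m.val + 1, hm⟩).val < m.val + 1 then -1
  else 0

/-- The code of `π` is `+^i 0^k -^j`. -/
def HasBlockCode {n : ℕ} (π : Equiv.Perm (Fin n)) (i k j : ℕ) : Prop :=
  i + k + j = n - 2 ∧
    ∀ m : Fin (n - 2), code π m = if m.val < i then 1 else if m.val < i + k then 0 else -1

/-- `Performs l π π'`: the displacements in the list `l` of pairs (value, new position) can be
performed one after the other, starting with `π`, and the result is `π'`. -/
def Performs {n : ℕ} : List (ℕ × ℕ) → Equiv.Perm (Fin n) → Equiv.Perm (Fin n) → Prop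
  | [], π, π' => π = π'
  | (a, b) :: l, π, π' =>
      ∃ (v t : Fin n) (ρ : Equiv.Perm (Fin n)),
        v.val = a ∧ t.val = b ∧ Displacement v t π ρ ∧ Performs l ρ π'

/-- The displacements of a left firing before its last one, for the fixed points
`p + 1, …, p + k`; all go into position `p`. Followed by the displacement of `p + k` into position
`p`, they transpose the entry in position `p` with the entry `p + k`. Unfolding the recursion, one
first transposes the entry in position `p` with `p + k - 1`, and then successively the new entry
in position `p` with `p + k - 2`, …, `p + 1`. -/
def leftPrefix (p : ℕ) : ℕ → List (ℕ × ℕ)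
  | 0 => []
  | 1 => []
  | k + 2 => (leftPrefix p (k + 1) ++ [(p + (k + 1), p)]) ++ leftPrefix p (k + 1)

/-- The mirror image of `leftPrefix`: the displacements of a right firing before its last one,
for the fixed points `p - k, …, p - 1`; all go into position `p`. -/
def rightPrefix (p : ℕ) : ℕ → List (ℕ × ℕ)
  | 0 => []
  | 1 => []
  | k + 2 => (rightPrefix p (k + 1) ++ [(p - (k + 1), p)]) ++ rightPrefix p (k + 1)

/-- A left firing: if the code of `π` is `+^i 0^k -^j` with `k ≥ 1`, the `2 ^ (k - 1)`
displacements described above are performed; the last one displaces the value `i + k` (that is,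
the number `i + k + 1`) into any position `s ≤ i` (that is, one of the first `i + 1` places). -/
def LeftFiring {n : ℕ} (π π' : Equiv.Perm (Fin n)) : Prop :=
  ∃ i k j s : ℕ, 1 ≤ k ∧ HasBlockCode π i k j ∧ s ≤ i ∧
    Performs (leftPrefix i k ++ [(i + k, s)]) π π'

/-- A right firing: if the code of `π` is `+^i 0^k -^j` with `k ≥ 1`, the last one of the
`2 ^ (k - 1)` displacements displaces the value `i + 1` (that is, the number `i + 2`) into any
position `s ≥ i + k + 1` (that is, one of the last `j + 1` places). -/
def RightFiring {n : ℕ} (π π' : Equiv.Perm (Fin n)) : Prop :=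
  ∃ i k j s : ℕ, 1 ≤ k ∧ HasBlockCode π i k j ∧ i + k + 1 ≤ s ∧ s < n ∧
    Performs (rightPrefix (i + k + 1) k ++ [(i + 1, s)]) π π'

/-- A firing, to the left or to the right. -/
def Firing {n : ℕ} (π π' : Equiv.Perm (Fin n)) : Prop :=
  LeftFiring π π' ∨ RightFiring π π'

end Homing

namespace Homing

/-! Reversing time, `σ` lies in `M n` iff some path of `2 ^ (n - 1) - 1` displacements leads from
the identity to `σ`; no path is longer (`mem_M_iff`). So the task is to describe the paths of this
length.

The bound comes from forgetting everything but the sign of each entry relative to its home. In the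
resulting game of signs, a run on `m` letters has at most `2 ^ m - 1` moves (`runBound`). Indeed,
once the leftmost letter has moved right, or the rightmost one left, that letter is frozen and at
most `2 ^ (m - 1) - 1` moves follow. Before that, each outer letter needs an inner move to bring it
home between two moves of its own, so the outer moves are controlled by the inner ones, and
induction gives the same bound. For paths from the identity, consider the first moment at which both
the smallest and the largest value are away from home. Until then one end has not taken part, so
induction on the interval applies; afterwards both ends stay away and the game on the `n - 2` inner
values applies. Equality forces all inner values to be at home at that moment, so the permutation is
`tau`, and a longest run on the inner values follows (`IsPath.exists_middle`, `eq_tau`).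

Equality in the game is rigid (`allRight`, `IsRun.longest`): up to reflection, all letters but the
last are moved, to the left only, until they are all to the left of home; then one left move of the
last letter brings them all home, and a longest run on them follows. A single displacement shifts by
one place only, so these letters were exactly one place from home. This determines the displacements
recursively (`performs_leftPrefix_of_path`): they form a firing, which uses up one zero of the block
code. Iteration gives `n - 2` firings. Conversely, firings have lengths `2 ^ (n - 3), …, 2, 1`, and
`tau` is reached from the identity in `2 ^ (n - 2)` displacements, which adds up to the maximum. -/

/-! ### The game of signs -/

/-- A move in the game of signs: the letter that is displaced, the direction (`1` for right, `-1`
for left), and the word after the move. -/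
structure SignMove where
  letter : ℤ
  dir : ℤ
  next : ℤ → ℤ

/-- The effect on the signs of the letters in `[a, a + m)` of displacing one of these letters:
the letter was at home and is now on the side to which it moves; letters on the other side
are unaffected, and those it may have passed are possibly shifted by one place. -/
def SignStep (a : ℤ) (m : ℕ) (s : ℤ → ℤ) (x : SignMove) : Prop :=
  a ≤ x.letter ∧ x.letter < a + m ∧ s x.letter = 0 ∧ x.next x.letter = x.dir ∧
    ((x.dir = 1 ∧ ∀ u, a ≤ u → u < a + m → (u < x.letter → x.next u = s u) ∧
        (x.letter < u → x.next u = s u ∨ (s u = 1 ∧ x.next u = 0) ∨ (s u = 0 ∧ x.next u = -1))) ∨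
      (x.dir = -1 ∧ ∀ u, a ≤ u → u < a + m → (x.letter < u → x.next u = s u) ∧
        (u < x.letter → x.next u = s u ∨ (s u = -1 ∧ x.next u = 0) ∨ (s u = 0 ∧ x.next u = 1))))

/-- A sequence of moves of letters in `[a, a + m)`, starting from the word `s`. -/
def IsRun (a : ℤ) (m : ℕ) : (ℤ → ℤ) → List SignMove → Prop
  | _, [] => True
  | s, x :: l => SignStep a m s x ∧ IsRun a m x.next l

/-- The word at the end of a sequence of moves. -/
def finalWord : (ℤ → ℤ) → List SignMove → ℤ → ℤ
  | s, [] => s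
  | _, x :: l => finalWord x.next l

@[simp] theorem isRun_nil (a : ℤ) (m : ℕ) (s : ℤ → ℤ) : IsRun a m s [] := trivial

@[simp] theorem isRun_cons {a : ℤ} {m : ℕ} {s : ℤ → ℤ} {x : SignMove} {l : List SignMove} :
    IsRun a m s (x :: l) ↔ SignStep a m s x ∧ IsRun a m x.next l := Iff.rfl

@[simp] theorem finalWord_nil (s : ℤ → ℤ) : finalWord s [] = s := rfl

@[simp] theorem finalWord_cons (s : ℤ → ℤ) (x : SignMove) (l : List SignMove) :
    finalWord s (x :: l) = finalWord x.next l := rfl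

theorem isRun_append {a : ℤ} {m : ℕ} {s : ℤ → ℤ} {l₁ l₂ : List SignMove} :
    IsRun a m s (l₁ ++ l₂) ↔ IsRun a m s l₁ ∧ IsRun a m (finalWord s l₁) l₂ := by
  induction l₁ generalizing s with
  | nil => simp
  | cons x l ih => simp [ih, and_assoc]

theorem finalWord_append (s : ℤ → ℤ) (l₁ l₂ : List SignMove) :
    finalWord s (l₁ ++ l₂) = finalWord (finalWord s l₁) l₂ := by
  induction l₁ generalizing s with
  | nil => simp
  | cons x l ih => simp [ih]

theorem SignStep.congr {a : ℤ} {m : ℕ} {s s' : ℤ → ℤ} {x : SignMove}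
    (h : ∀ u, a ≤ u → u < a + m → s u = s' u) (hx : SignStep a m s x) : SignStep a m s' x := by
  obtain ⟨h1, h2, h3, h4, h5⟩ := hx
  refine ⟨h1, h2, by rw [← h _ h1 h2, h3], h4, ?_⟩
  rcases h5 with ⟨hd, h5⟩ | ⟨hd, h5⟩
  · exact Or.inl ⟨hd, fun u hu hu' => by rw [← h u hu hu']; exact h5 u hu hu'⟩
  · exact Or.inr ⟨hd, fun u hu hu' => by rw [← h u hu hu']; exact h5 u hu hu'⟩

theorem IsRun.congr {a : ℤ} {m : ℕ} {s s' : ℤ → ℤ} {l : List SignMove}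
    (h : ∀ u, a ≤ u → u < a + m → s u = s' u) (hl : IsRun a m s l) : IsRun a m s' l := by
  cases l with
  | nil => trivial
  | cons x l => exact ⟨hl.1.congr h, hl.2⟩

theorem finalWord_congr {s s' : ℤ → ℤ} {u : ℤ} (h : s u = s' u) (l : List SignMove) :
    finalWord s l u = finalWord s' l u := by
  cases l with
  | nil => exact h
  | cons x l => rfl

/-- Restriction of a move to a subinterval that contains its letter. -/
theorem SignStep.restrict {a b : ℤ} {m k : ℕ} {s : ℤ → ℤ} {x : SignMove} (hx : SignStep a m s x)
    (hab : a ≤ b) (hbk : b + k ≤ a + m) (h1 : b ≤ x.letter) (h2 : x.letter < b + k) :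
    SignStep b k s x := by
  obtain ⟨-, -, h3, h4, h5⟩ := hx
  refine ⟨h1, h2, h3, h4, ?_⟩
  rcases h5 with ⟨hd, h5⟩ | ⟨hd, h5⟩
  · exact Or.inl ⟨hd, fun u hu hu' => h5 u (by omega) (by omega)⟩
  · exact Or.inr ⟨hd, fun u hu hu' => h5 u (by omega) (by omega)⟩

theorem IsRun.restrict {a b : ℤ} {m k : ℕ} {s : ℤ → ℤ} {l : List SignMove} (hl : IsRun a m s l)
    (hab : a ≤ b) (hbk : b + k ≤ a + m) (h : ∀ x ∈ l, b ≤ x.letter ∧ x.letter < b + k) :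
    IsRun b k s l := by
  induction l generalizing s with
  | nil => trivial
  | cons x l ih =>
    have := h x (by simp)
    exact ⟨hl.1.restrict hab hbk this.1 this.2, ih hl.2 fun y hy => h y (by simp [hy])⟩

theorem IsRun.letter_mem {a : ℤ} {m : ℕ} {s : ℤ → ℤ} {l : List SignMove} (hl : IsRun a m s l) :
    ∀ x ∈ l, a ≤ x.letter ∧ x.letter < a + m := by
  induction l generalizing s with
  | nil => simp
  | cons x l ih =>
    intro y hy
    rcases List.mem_cons.1 hy with rfl | hy
    · exact ⟨hl.1.1, hl.1.2.1⟩
    · exact ih hl.2 y hy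

/-! ### Reflection -/

/-- The reflected word. -/
def reflectWord (s : ℤ → ℤ) (u : ℤ) : ℤ := -s (-u)

/-- The reflected move. -/
def SignMove.reflect (x : SignMove) : SignMove := ⟨-x.letter, -x.dir, reflectWord x.next⟩

theorem SignStep.reflect {a : ℤ} {m : ℕ} {s : ℤ → ℤ} {x : SignMove} (hx : SignStep a m s x) :
    SignStep (1 - a - m) m (reflectWord s) x.reflect := by
  obtain ⟨h1, h2, h3, h4, h5⟩ := hx
  refine ⟨by simp only [SignMove.reflect]; omega, by simp only [SignMove.reflect]; omega,
    by simp [SignMove.reflect, reflectWord, h3], by simp [SignMove.reflect, reflectWord, h4], ?_⟩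
  simp only [SignMove.reflect, reflectWord]
  rcases h5 with ⟨hd, h5⟩ | ⟨hd, h5⟩
  · refine Or.inr ⟨by omega, fun u hu hu' => ?_⟩
    have := h5 (-u) (by omega) (by omega)
    constructor <;> intro hlt
    · rw [this.1 (by omega)]
    · have := this.2 (by omega)
      omega
  · refine Or.inl ⟨by omega, fun u hu hu' => ?_⟩
    have := h5 (-u) (by omega) (by omega)
    constructor <;> intro hlt
    · rw [this.1 (by omega)]
    · have := this.2 (by omega)
      omega

theorem IsRun.reflect {a : ℤ} {m : ℕ} {s : ℤ → ℤ} {l : List SignMove} (hl : IsRun a m s l) :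
    IsRun (1 - a - m) m (reflectWord s) (l.map SignMove.reflect) := by
  induction l generalizing s with
  | nil => trivial
  | cons x l ih => exact ⟨hl.1.reflect, ih hl.2⟩

theorem finalWord_reflect (s : ℤ → ℤ) (l : List SignMove) :
    finalWord (reflectWord s) (l.map SignMove.reflect) = reflectWord (finalWord s l) := by
  induction l generalizing s with
  | nil => rfl
  | cons x l ih => exact ih _

/-! ### Extremal letters -/

/-- The leftmost letter is never displaced again once it is to the right of its home. -/
theorem IsRun.frozen_left {a : ℤ} {m : ℕ} {s : ℤ → ℤ} {l : List SignMove}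
    (hl : IsRun a (m + 1) s l) (hs : s a = 1) :
    IsRun (a + 1) m s l ∧ finalWord s l a = 1 := by
  induction l generalizing s with
  | nil => simpa using hs
  | cons x l ih =>
    obtain ⟨hx, hl⟩ := hl
    have hx' := hx
    obtain ⟨h1, h2, h3, h4, h5⟩ := hx
    have hne : x.letter ≠ a := fun h => by rw [h, hs] at h3; omega
    have hn : x.next a = 1 := by
      rcases h5 with ⟨hd, h5⟩ | ⟨hd, h5⟩
      · rw [(h5 a le_rfl (by omega)).1 (by omega), hs]
      · have := (h5 a le_rfl (by omega)).2 (by omega)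
        omega
    exact ⟨⟨hx'.restrict (by omega) (by omega) (by omega) (by omega), (ih hl hn).1⟩, (ih hl hn).2⟩

/-- The rightmost letter is never displaced again once it is to the left of its home. -/
theorem IsRun.frozen_right {a : ℤ} {m : ℕ} {s : ℤ → ℤ} {l : List SignMove}
    (hl : IsRun a (m + 1) s l) (hs : s (a + m) = -1) :
    IsRun a m s l ∧ finalWord s l (a + m) = -1 := by
  have e : -(1 - a - ((m + 1 : ℕ) : ℤ)) = a + m := by push_cast; ring
  have := hl.reflect.frozen_left (by rw [reflectWord, e, hs]; rfl)
  constructor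
  · refine hl.restrict le_rfl (by push_cast; omega) fun x hx => ?_
    have := this.1.letter_mem x.reflect (List.mem_map_of_mem hx)
    simp only [SignMove.reflect] at this
    push_cast at this
    omega
  · have h2 := this.2
    rw [finalWord_reflect, reflectWord] at h2
    rw [e] at h2
    omega

/-- A move that permanently removes an extremal letter from the game. -/
def SignMove.Extremal (a : ℤ) (m : ℕ) (x : SignMove) : Prop :=
  (x.letter = a ∧ x.dir = 1) ∨ (x.letter = a + m - 1 ∧ x.dir = -1)

theorem SignMove.Extremal.reflect {a : ℤ} {m : ℕ} {x : SignMove} :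
    x.reflect.Extremal (1 - a - m) m ↔ x.Extremal a m := by
  simp only [SignMove.Extremal, SignMove.reflect]
  omega

theorem exists_first_extremal (a : ℤ) (m : ℕ) (l : List SignMove) :
    (∀ x ∈ l, ¬ x.Extremal a m) ∨
      ∃ l₁ x l₂, l = l₁ ++ x :: l₂ ∧ x.Extremal a m ∧ ∀ y ∈ l₁, ¬ y.Extremal a m := by
  induction l with
  | nil => simp
  | cons x l ih =>
    by_cases hx : x.Extremal a m
    · exact Or.inr ⟨[], x, l, rfl, hx, by simp⟩
    · rcases ih with h | ⟨l₁, y, l₂, rfl, hy, h⟩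
      · left
        intro y hy
        rcases List.mem_cons.1 hy with rfl | hy
        exacts [hx, h y hy]
      · refine Or.inr ⟨x :: l₁, y, l₂, rfl, hy, fun z hz => ?_⟩
        rcases List.mem_cons.1 hz with rfl | hz
        exacts [hx, h z hz]

/-- As long as there is no extremal move, the moves of the two extremal letters have no influence on
the other letters, and between any two of them there is a move of an inner letter. -/
theorem IsRun.inner {a : ℤ} {m : ℕ} {s : ℤ → ℤ} {l : List SignMove} (hl : IsRun a (m + 2) s l)
    (hq : ∀ x ∈ l, ¬ x.Extremal a (m + 2)) :
    ∃ (l' : List SignMove) (p q α β : ℕ), IsRun (a + 1) m s l' ∧ l'.length = p + q ∧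
      l.length = l'.length + α + β ∧
      α + (if s a = 0 then 0 else 1) ≤ p + (if finalWord s l a = 0 then 0 else 1) ∧
      β + (if s (a + m + 1) = 0 then 0 else 1) ≤
        q + (if finalWord s l (a + m + 1) = 0 then 0 else 1) ∧
      (∀ u, a < u → u < a + m + 1 → finalWord s l' u = finalWord s l u) ∧
      ((∀ x ∈ l', x.dir = 1) → p = 0) ∧
      ((∀ x ∈ l', x.dir = 1) → α = 0 → ∀ x ∈ l, x.dir = 1 ∧ x.letter ≠ a) := by
  induction l generalizing s with
  | nil => exact ⟨[], 0, 0, 0, 0, by simp, rfl, rfl, le_rfl, le_rfl, by simp, by simp, by simp⟩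
  | cons x l ih =>
    obtain ⟨hx, hl⟩ := hl
    obtain ⟨l', p, q, α, β, hr, h1, h2, h3, h4, h5, h6, h7⟩ := ih hl fun y hy => hq y (by simp [hy])
    have hx' := hx
    have hqx := hq x (by simp)
    simp only [SignMove.Extremal] at hqx
    push_cast at hqx
    obtain ⟨g1, g2, g3, g4, g5⟩ := hx
    push_cast at g2 g5
    by_cases ha : x.letter = a
    · have hd : x.dir = -1 := by omega
      -- A left move affects only smaller letters, and the first letter has none; so this move can
      -- be dropped from the inner run.
      have hs : ∀ u, a + 1 ≤ u → u < a + m + 2 → x.next u = s u := by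
        rcases g5 with ⟨hd', g5⟩ | ⟨hd, g5⟩
        · omega
        · exact fun u hu hu' => (g5 u (by omega) (by omega)).1 (by omega)
      rw [ha] at g3 g4
      refine ⟨l', p, q, α + 1, β, hr.congr fun u hu hu' => hs u hu (by omega), h1, ?_, ?_, ?_, ?_,
        h6, ?_⟩
      · simp only [List.length_cons]; omega
      -- The indicator of "first letter away from home" is a potential: a move of that letter raises
      -- it from 0 to 1, and only an inner left move, counted by `p`, can lower it.
      · rw [if_neg (by omega)] at h3
        rw [if_pos g3, finalWord_cons]
        omega
      · rw [← hs _ (by omega) (by omega)]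
        exact h4
      · intro u hu hu'
        rw [finalWord_cons, ← h5 u hu hu']
        exact finalWord_congr (hs u (by omega) (by omega)).symm _
      · intro _ h
        omega
    by_cases hb : x.letter = a + m + 1
    · have hd : x.dir = 1 := by omega
      have hs : ∀ u, a ≤ u → u < a + m + 1 → x.next u = s u := by
        rcases g5 with ⟨hd, g5⟩ | ⟨hd', g5⟩
        · exact fun u hu hu' => (g5 u (by omega) (by omega)).1 (by omega)
        · omega
      rw [hb] at g3 g4
      refine ⟨l', p, q, α, β + 1, hr.congr fun u hu hu' => hs u (by omega) (by omega), h1, ?_, ?_,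
        ?_, ?_, h6, ?_⟩
      · simp only [List.length_cons]; omega
      · rw [← hs _ (by omega) (by omega)]
        exact h3
      · rw [if_neg (by omega)] at h4
        rw [if_pos g3, finalWord_cons]
        omega
      · intro u hu hu'
        rw [finalWord_cons, ← h5 u hu hu']
        exact finalWord_congr (hs u (by omega) (by omega)).symm _
      · intro h h' y hy
        rcases List.mem_cons.1 hy with rfl | hy
        exacts [⟨hd, ha⟩, h7 h h' y hy]
    · have hin : SignStep (a + 1) m s x :=
        hx'.restrict (by omega) (by push_cast; omega) (by omega) (by omega)
      rcases g5 with ⟨hd, g5⟩ | ⟨hd, g5⟩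
      · refine ⟨x :: l', p, q + 1, α, β, ⟨hin, hr⟩, ?_, ?_, ?_, ?_, h5, ?_, ?_⟩
        · simp only [List.length_cons]; omega
        · simp only [List.length_cons]; omega
        · rw [← (g5 a (by omega) (by omega)).1 (by omega)]
          exact h3
        · rw [finalWord_cons]
          split_ifs at h4 ⊢ <;> omega
        · intro h
          exact h6 fun y hy => h y (by simp [hy])
        · intro h h' y hy
          rcases List.mem_cons.1 hy with rfl | hy
          exacts [⟨hd, ha⟩, h7 (fun y hy => h y (by simp [hy])) h' y hy]
      · refine ⟨x :: l', p + 1, q, α, β, ⟨hin, hr⟩, ?_, ?_, ?_, ?_, h5, ?_, ?_⟩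
        · simp only [List.length_cons]; omega
        · simp only [List.length_cons]; omega
        · rw [finalWord_cons]
          split_ifs at h3 ⊢ <;> omega
        · rw [← (g5 (a + m + 1) (by omega) (by omega)).1 (by omega)]
          exact h4
        · intro h
          have := h x (by simp)
          omega
        · intro h
          have := h x (by simp)
          omega

/-! ### The bound for the game of signs -/

/-- On `m` letters there are at most `2 ^ m - 1` moves, with equality only if all letters are at
home at the beginning. -/
def RunBound (m : ℕ) : Prop :=
  ∀ (a : ℤ) (s : ℤ → ℤ) (l : List SignMove), IsRun a m s l →
    l.length + 1 ≤ 2 ^ m ∧ (l.length + 1 = 2 ^ m → ∀ u, a ≤ u → u < a + m → s u = 0)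

/-- A run without an extremal move is far from longest: the two outer letters move at most `p + 1`
and `q + 1` times, where `p + q` is the number of inner moves, so the total is at most `2 * (2 ^ (m
- 2) - 1) + 2` when `m ≥ 2`. -/
theorem IsRun.length_le_of_inner {a : ℤ} {m : ℕ} (hm : ∀ k < m, RunBound k) {s : ℤ → ℤ}
    {l : List SignMove} (hl : IsRun a m s l) (hq : ∀ x ∈ l, ¬ x.Extremal a m) (h0 : 1 ≤ m) :
    l.length + 1 ≤ 2 ^ (m - 1) + 1 ∧ l.length + 1 < 2 ^ m := by
  match m, h0 with
  | 1, _ =>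
    cases l with
    | nil => simp
    | cons x l =>
      refine absurd ?_ (hq x (by simp))
      obtain ⟨h1, h2, -, -, h5⟩ := hl.1
      push_cast at h2
      have : x.letter = a := by omega
      rcases h5 with ⟨hd, -⟩ | ⟨hd, -⟩
      · exact Or.inl ⟨this, hd⟩
      · exact Or.inr ⟨by push_cast; omega, hd⟩
  | m + 2, _ =>
    obtain ⟨l', p, q, α, β, hr, h1, h2, h3, h4, -⟩ := hl.inner hq
    have := (hm m (by omega) _ _ _ hr).1
    have hα : α ≤ p + 1 := by split_ifs at h3 <;> omega
    have hβ : β ≤ q + 1 := by split_ifs at h4 <;> omega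
    have e1 : 2 ^ (m + 2 - 1) = 2 * 2 ^ m := by rw [show m + 2 - 1 = m + 1 by omega]; ring
    have e2 : 2 ^ (m + 2) = 4 * 2 ^ m := by ring
    have : 0 < 2 ^ m := by positivity
    omega

/-- This is the situation just before the first letter makes its extremal move. As it ends at home,
it has moved at most `p` times instead of `p + 1`, and the one move saved makes the bound sharp. -/
theorem IsRun.length_le_of_right {a : ℤ} {m : ℕ} (hm : ∀ k < m, RunBound k) {s : ℤ → ℤ}
    {l : List SignMove} (hl : IsRun a (m + 1) s l) (hq : ∀ x ∈ l, ¬ x.Extremal a (m + 1))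
    (ha : finalWord s l a = 0) :
    l.length + 1 ≤ 2 ^ m ∧
      (l.length + 1 = 2 ^ m → ∀ u, a ≤ u → u < a + (m + 1) → s u = 0) := by
  match m with
  | 0 =>
    cases l with
    | nil =>
      refine ⟨by simp, fun _ u hu hu' => ?_⟩
      rw [show u = a by push_cast at hu'; omega]
      exact ha
    | cons x l =>
      have := (hl.length_le_of_inner (fun k hk => by
        obtain rfl : k = 0 := by omega
        intro a s l hl
        cases l with
        | nil => simp; intros; omega
        | cons y l =>
          have h1 := hl.1.1
          have h2 := hl.1.2.1
          push_cast at h2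
          omega) hq (by omega)).2
      simp at this
  | m + 1 =>
    obtain ⟨l', p, q, α, β, hr, h1, h2, h3, h4, -⟩ := hl.inner hq
    have hb := hm m (by omega) _ _ _ hr
    have hb1 := hb.1
    rw [if_pos ha] at h3
    have hβ : β ≤ q + 1 := by split_ifs at h4 <;> omega
    have e1 : 2 ^ (m + 1) = 2 * 2 ^ m := by ring
    have : 0 < 2 ^ m := by positivity
    refine ⟨by omega, fun h u hu hu' => ?_⟩
    by_cases hua : u = a
    · subst hua
      by_contra hne
      rw [if_neg hne] at h3
      omega
    by_cases hub : u = a + m + 1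
    · subst hub
      by_contra hne
      rw [if_neg hne] at h4
      split_ifs at h4 <;> omega
    · exact hb.2 (by omega) u (by omega) (by push_cast at hu'; omega)

theorem isRun_bound_of_right {a : ℤ} {m : ℕ} (hm : ∀ k ≤ m, RunBound k) {s : ℤ → ℤ}
    {l₁ l₂ : List SignMove} {x : SignMove} (hl : IsRun a (m + 1) s (l₁ ++ x :: l₂))
    (hx : x.letter = a ∧ x.dir = 1) (hq : ∀ x ∈ l₁, ¬ x.Extremal a (m + 1)) :
    l₁.length + 1 ≤ 2 ^ m ∧ l₂.length + 1 ≤ 2 ^ m ∧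
      (l₁.length + 1 = 2 ^ m → ∀ u, a ≤ u → u < a + (m + 1) → s u = 0) := by
  obtain ⟨hl₁, hx', hl₂⟩ := isRun_append.1 hl
  obtain ⟨-, -, h3, h4, -⟩ := hx'
  rw [hx.1] at h3 h4
  have h := hl₁.length_le_of_right (fun k hk => hm k (by omega)) hq h3
  exact ⟨h.1, (hm m le_rfl _ _ _ (hl₂.frozen_left (by rw [h4, hx.2])).1).1, h.2⟩

theorem isRun_bound_of_left {a : ℤ} {m : ℕ} (hm : ∀ k ≤ m, RunBound k) {s : ℤ → ℤ}
    {l₁ l₂ : List SignMove} {x : SignMove} (hl : IsRun a (m + 1) s (l₁ ++ x :: l₂))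
    (hx : x.letter = a + m ∧ x.dir = -1) (hq : ∀ x ∈ l₁, ¬ x.Extremal a (m + 1)) :
    l₁.length + 1 ≤ 2 ^ m ∧ l₂.length + 1 ≤ 2 ^ m ∧
      (l₁.length + 1 = 2 ^ m → ∀ u, a ≤ u → u < a + (m + 1) → s u = 0) := by
  have hr := hl.reflect
  rw [List.map_append, List.map_cons] at hr
  have h := isRun_bound_of_right hm hr
    ⟨by simp only [SignMove.reflect]; push_cast; omega, by simp only [SignMove.reflect]; omega⟩
    (fun y hy => by
      obtain ⟨z, hz, rfl⟩ := List.mem_map.1 hy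
      rw [SignMove.Extremal.reflect]
      exact hq z hz)
  simp only [List.length_map] at h
  refine ⟨h.1, h.2.1, fun h1 u hu hu' => ?_⟩
  have := h.2.2 h1 (-u) (by push_cast; omega) (by push_cast; omega)
  simp only [reflectWord, neg_neg] at this
  omega

theorem runBound (m : ℕ) : RunBound m := by
  induction m using Nat.strong_induction_on with
  | _ m ih =>
  intro a s l hl
  match m with
  | 0 =>
    cases l with
    | nil => simp; intros; omega
    | cons y l =>
      have h1 := hl.1.1
      have h2 := hl.1.2.1
      push_cast at h2
      omega
  | m + 1 =>
    have ih' : ∀ k ≤ m, RunBound k := fun k hk => ih k (by omega)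
    rcases exists_first_extremal a (m + 1) l with hq | ⟨l₁, x, l₂, rfl, hx, hq⟩
    · have := (hl.length_le_of_inner ih hq (by omega)).2
      omega
    · have key : l₁.length + 1 ≤ 2 ^ m ∧ l₂.length + 1 ≤ 2 ^ m ∧
          (l₁.length + 1 = 2 ^ m → ∀ u, a ≤ u → u < a + (m + 1) → s u = 0) := by
        rcases hx with hx | hx
        · exact isRun_bound_of_right ih' hl hx hq
        · exact isRun_bound_of_left ih' hl ⟨by push_cast at hx; omega, hx.2⟩ hq
      have e1 : 2 ^ (m + 1) = 2 * 2 ^ m := by ring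
      simp only [List.length_append, List.length_cons]
      exact ⟨by omega, fun h u hu hu' => key.2.2 (by omega) u hu (by push_cast at hu'; omega)⟩

/-- A letter at home at the end could be moved once more, against `runBound`. The added move leaves
all other signs alone, which the rules of the game permit. -/
theorem IsRun.finalWord_ne_zero {a : ℤ} {m : ℕ} {s : ℤ → ℤ} {l : List SignMove}
    (hl : IsRun a m s l) (hlen : l.length + 1 = 2 ^ m) {u : ℤ} (hu : a ≤ u) (hu' : u < a + m) :
    finalWord s l u ≠ 0 := by
  intro h0
  have := (runBound m a s (l ++ [⟨u, 1, Function.update (finalWord s l) u 1⟩])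
    (isRun_append.2 ⟨hl, ⟨hu, hu', h0, by simp, Or.inl ⟨rfl, fun w _ _ => ⟨fun hw => ?_,
      fun hw => Or.inl ?_⟩⟩⟩, trivial⟩)).1
  · simp only [List.length_append, List.length_cons, List.length_nil] at this
    omega
  · exact Function.update_of_ne (by dsimp only at hw; omega) _ _
  · exact Function.update_of_ne (by dsimp only at hw; omega) _ _

/-! ### Rigidity of longest runs -/

/-- On `m` letters, a longest sequence of moves that ends with all letters to the right of their
homes consists of moves to the right. -/
def AllRight (m : ℕ) : Prop :=
  ∀ (a : ℤ) (s : ℤ → ℤ) (l : List SignMove), IsRun a m s l → l.length + 1 = 2 ^ m →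
    (∀ u, a ≤ u → u < a + m → finalWord s l u = 1) → ∀ x ∈ l, x.dir = 1

/-- Both halves are as long as possible, so equality holds in every estimate behind the bound: `l₂`
must start with its letters at home, the inner part of `l₁` is itself a longest run, and the last
letter moves `q + 1` times. -/
theorem allRight_of_right {a : ℤ} {m : ℕ} (hm : ∀ k < m, AllRight k) {s : ℤ → ℤ}
    {l₁ l₂ : List SignMove} {x : SignMove} (hl : IsRun a (m + 1) s (l₁ ++ x :: l₂))
    (hx : x.letter = a ∧ x.dir = 1) (hq : ∀ x ∈ l₁, ¬ x.Extremal a (m + 1))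
    (h₁ : l₁.length + 1 = 2 ^ m) (h₂ : l₂.length + 1 = 2 ^ m) :
    (∀ y ∈ l₁, y.dir = 1 ∧ y.letter ≠ a) ∧
      (∀ u, a < u → u < a + (m + 1) → finalWord s l₁ u = 1 ∧ x.next u = 0) := by
  obtain ⟨hl₁, hx', hl₂⟩ := isRun_append.1 hl
  obtain ⟨-, -, h3, h4, h5⟩ := hx'
  rw [hx.1] at h3 h4
  have hz := (runBound m _ _ _ (hl₂.frozen_left (by rw [h4, hx.2])).1).2 h₂
  have hz' : ∀ u, a < u → u < a + (m + 1) → x.next u = 0 :=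
    fun u hu hu' => hz u (by omega) (by omega)
  -- A right move of the first letter never raises a sign, so a letter that is at home after `x` had
  -- sign 0 or 1 before it.
  have hf : ∀ u, a < u → u < a + (m + 1) → finalWord s l₁ u ≠ 0 → finalWord s l₁ u = 1 := by
    intro u hu hu' hne
    have h0 := hz' u hu hu'
    rcases h5 with ⟨-, h5⟩ | ⟨hd, -⟩
    · have := (h5 u (by omega) (by push_cast; omega)).2 (by omega)
      omega
    · omega
  match m with
  | 0 =>
    obtain rfl : l₁ = [] := List.length_eq_zero_iff.1 (by simpa using h₁)
    exact ⟨by simp, fun u hu hu' => by push_cast at hu'; omega⟩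
  | m + 1 =>
    obtain ⟨l', p, q, α, β, hr, g1, g2, g3, g4, g5, g6, g7⟩ := hl₁.inner hq
    have hb := runBound m _ _ _ hr
    have hb1 := hb.1
    rw [if_pos h3] at g3
    have hβ : β ≤ q + 1 := by split_ifs at g4 <;> omega
    have e1 : 2 ^ (m + 1) = 2 * 2 ^ m := by ring
    have : 0 < 2 ^ m := by positivity
    have hmid : ∀ u, a < u → u < a + m + 1 → finalWord s l₁ u = 1 := fun u hu hu' =>
      hf u hu (by push_cast; omega)
        (by rw [← g5 u hu hu']; exact hr.finalWord_ne_zero (by omega) (by omega) (by omega))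
    have hR := hm m (by omega) _ _ _ hr (by omega)
      fun u hu hu' => by rw [g5 u (by omega) (by omega)]; exact hmid u (by omega) (by omega)
    have hp := g6 hR
    -- Without inner left moves `p = 0`, and since the first letter ends at home this forces `α =
    -- 0`.
    refine ⟨g7 hR (by omega), fun u hu hu' => ⟨?_, hz' u hu hu'⟩⟩
    by_cases hub : u = a + m + 1
    · refine hf u hu hu' fun h0 => ?_
      rw [hub] at h0
      rw [if_pos h0] at g4
      omega
    · exact hmid u hu (by push_cast at hu'; omega)

theorem allRight (m : ℕ) : AllRight m := by
  induction m using Nat.strong_induction_on with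
  | _ m ih =>
  intro a s l hl hlen hfin
  match m with
  | 0 =>
    obtain rfl : l = [] := List.length_eq_zero_iff.1 (by simpa using hlen)
    simp
  | m + 1 =>
    have e1 : 2 ^ (m + 1) = 2 * 2 ^ m := by ring
    rcases exists_first_extremal a (m + 1) l with hq | ⟨l₁, x, l₂, rfl, hx, hq⟩
    · have := (hl.length_le_of_inner (fun k _ => runBound k) hq (by omega)).2
      omega
    simp only [List.length_append, List.length_cons] at hlen
    obtain ⟨hl₁, hx', hl₂⟩ := isRun_append.1 hl
    obtain ⟨-, -, h3, h4, h5⟩ := hx'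
    rcases hx with hx | hx
    · obtain ⟨hb1, hb2, -⟩ := isRun_bound_of_right (fun k _ => runBound k) hl hx hq
      have h := allRight_of_right (fun k hk => ih k (by omega)) hl hx hq (by omega) (by omega)
      have h2 := ih m (by omega) _ _ _ (hl₂.frozen_left (by rw [← hx.1, h4, hx.2])).1 (by omega)
        fun u hu hu' => by
          have := hfin u (by omega) (by push_cast; omega)
          rwa [finalWord_append, finalWord_cons] at this
      intro y hy
      rcases List.mem_append.1 hy with hy | hy
      · exact (h.1 y hy).1
      rcases List.mem_cons.1 hy with rfl | hy
      exacts [hx.2, h2 y hy]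
    -- If the last letter made the first extremal move, it would be frozen to the left of home,
    -- against `hfin`.
    · have hxl : x.letter = a + m := by push_cast at hx; omega
      have h := (hl₂.frozen_right (by rw [← hxl, h4, hx.2])).2
      have h' := hfin (a + m) (by omega) (by push_cast; omega)
      rw [finalWord_append, finalWord_cons, h] at h'
      omega

/-- A longest sequence of moves on `m + 1` letters, up to reflection: only inner moves to the right
until all letters but the first one are to the right of their homes, then a move of the
first letter that brings all other letters back home, and then a longest sequence of moves on the
other letters. -/
theorem IsRun.longest {a : ℤ} {m : ℕ} {s : ℤ → ℤ} {l : List SignMove}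
    (hl : IsRun a (m + 1) s l) (hlen : l.length + 1 = 2 ^ (m + 1)) :
    ∃ l₁ x l₂, l = l₁ ++ x :: l₂ ∧ l₁.length + 1 = 2 ^ m ∧ l₂.length + 1 = 2 ^ m ∧
      ((x.letter = a ∧ x.dir = 1 ∧ (∀ y ∈ l₁, y.dir = 1 ∧ y.letter ≠ a) ∧
        (∀ u, a < u → u < a + (m + 1) → finalWord s l₁ u = 1 ∧ x.next u = 0)) ∨
      (x.letter = a + m ∧ x.dir = -1 ∧ (∀ y ∈ l₁, y.dir = -1 ∧ y.letter ≠ a + m) ∧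
        (∀ u, a ≤ u → u < a + m → finalWord s l₁ u = -1 ∧ x.next u = 0))) := by
  have e1 : 2 ^ (m + 1) = 2 * 2 ^ m := by ring
  rcases exists_first_extremal a (m + 1) l with hq | ⟨l₁, x, l₂, rfl, hx, hq⟩
  · have := (hl.length_le_of_inner (fun k _ => runBound k) hq (by omega)).2
    omega
  simp only [List.length_append, List.length_cons] at hlen
  refine ⟨l₁, x, l₂, rfl, ?_⟩
  rcases hx with hx | hx
  · obtain ⟨hb1, hb2, -⟩ := isRun_bound_of_right (fun k _ => runBound k) hl hx hq
    have h := allRight_of_right (fun k _ => allRight k) hl hx hq (by omega) (by omega)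
    exact ⟨by omega, by omega, Or.inl ⟨hx.1, hx.2, h⟩⟩
  · have hxl : x.letter = a + m := by push_cast at hx; omega
    obtain ⟨hb1, hb2, -⟩ := isRun_bound_of_left (fun k _ => runBound k) hl ⟨hxl, hx.2⟩ hq
    have hr := hl.reflect
    rw [List.map_append, List.map_cons] at hr
    have h := allRight_of_right (fun k _ => allRight k) hr
      ⟨by simp only [SignMove.reflect]; push_cast; omega, by simp only [SignMove.reflect]; omega⟩
      (fun y hy => by
        obtain ⟨z, hz, rfl⟩ := List.mem_map.1 hy
        rw [SignMove.Extremal.reflect]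
        exact hq z hz) (by rw [List.length_map]; omega) (by rw [List.length_map]; omega)
    refine ⟨by omega, by omega, Or.inr ⟨hxl, hx.2, fun y hy => ?_, fun u hu hu' => ?_⟩⟩
    · have := h.1 _ (List.mem_map_of_mem hy)
      simp only [SignMove.reflect] at this
      push_cast at this
      omega
    · have := h.2 (-u) (by push_cast; omega) (by push_cast; omega)
      rw [finalWord_reflect] at this
      simp only [SignMove.reflect, reflectWord, neg_neg] at this
      omega

variable {n : ℕ}

/-! ### Positions -/

/-- The position of the entry `u`, extended to all integers by the identity. -/
def pos (π : Equiv.Perm (Fin n)) (u : ℤ) : ℤ :=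
  if h : 0 ≤ u ∧ u < n then ((π.symm ⟨u.toNat, by omega⟩).val : ℤ) else u

theorem pos_coe (π : Equiv.Perm (Fin n)) (v : Fin n) : pos π (v.val : ℤ) = ((π.symm v).val : ℤ) := by
  have := v.isLt
  simp [pos]

theorem pos_mem (π : Equiv.Perm (Fin n)) {u : ℤ} (h : 0 ≤ u) (h' : u < n) :
    0 ≤ pos π u ∧ pos π u < n := by
  lift u to ℕ using h
  have := pos_coe π ⟨u, by omega⟩
  simp only at this
  rw [this]
  exact ⟨by omega, by have := (π.symm ⟨u, by omega⟩).isLt; omega⟩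

theorem pos_of_not_mem (π : Equiv.Perm (Fin n)) {u : ℤ} (h : ¬ (0 ≤ u ∧ u < n)) : pos π u = u := by
  simp [pos, h]

theorem pos_injective (π : Equiv.Perm (Fin n)) : Function.Injective (pos π) := by
  intro u w h
  by_cases hu : 0 ≤ u ∧ u < n <;> by_cases hw : 0 ≤ w ∧ w < n
  · obtain ⟨hu, hu'⟩ := hu
    obtain ⟨hw, hw'⟩ := hw
    lift u to ℕ using hu
    lift w to ℕ using hw
    have h1 := pos_coe π ⟨u, by omega⟩
    have h2 := pos_coe π ⟨w, by omega⟩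
    simp only at h1 h2
    rw [h1, h2, Nat.cast_inj, Fin.val_inj, EmbeddingLike.apply_eq_iff_eq, Fin.mk.injEq] at h
    omega
  · have := pos_mem π hu.1 hu.2
    rw [h, pos_of_not_mem π hw] at this
    exact absurd this hw
  · have := pos_mem π hw.1 hw.2
    rw [← h, pos_of_not_mem π hu] at this
    exact absurd this hu
  · rwa [pos_of_not_mem π hu, pos_of_not_mem π hw] at h

theorem pos_ext {π π' : Equiv.Perm (Fin n)} (h : ∀ u : ℤ, 0 ≤ u → u < n → pos π u = pos π' u) :
    π = π' := by
  apply Equiv.symm_bijective.injective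
  ext v
  have := h v.val (by omega) (by have := v.isLt; omega)
  rw [pos_coe, pos_coe] at this
  exact_mod_cast this

theorem pos_one (u : ℤ) : pos (1 : Equiv.Perm (Fin n)) u = u := by
  by_cases hu : 0 ≤ u ∧ u < n
  · obtain ⟨hu, hu'⟩ := hu
    lift u to ℕ using hu
    have h1 := pos_coe (1 : Equiv.Perm (Fin n)) ⟨u, by omega⟩
    exact h1
  · exact pos_of_not_mem _ hu

/-- The new position of the entry in position `q ≠ p` after the entry in position `p` has been moved
to position `t`. -/
def shift (p t q : ℤ) : ℤ :=
  if p < q ∧ q ≤ t then q - 1 else if t ≤ q ∧ q < p then q + 1 else q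

theorem pos_moveTo (π : Equiv.Perm (Fin n)) (v t : Fin n) (u : ℤ) :
    pos (moveTo π v t) u =
      if u = v.val then (t.val : ℤ) else shift (pos π v.val) t.val (pos π u) := by
  have := NeZero.of_pos v.pos
  have ht := t.isLt
  have hv := v.isLt
  by_cases hu : 0 ≤ u ∧ u < n
  · obtain ⟨hu, hu'⟩ := hu
    lift u to ℕ using hu
    obtain ⟨w, rfl⟩ : ∃ w : Fin n, w.val = u := ⟨⟨u, by omega⟩, rfl⟩
    rw [pos_coe, pos_coe, pos_coe, moveTo]
    simp only [Nat.cast_inj, Fin.val_inj]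
    have hwq := (π.symm.injective.eq_iff (a := w) (b := v))
    generalize hp : π.symm v = p at *
    generalize hq : π.symm w = q at *
    have hpl := p.isLt
    have hql := q.isLt
    simp only [← hwq, shift]
    split_ifs with h1 h2 h3 h4
    · rw [Equiv.Perm.mul_def, Equiv.symm_trans_apply, hq, h2, Nat.cast_inj, Fin.val_inj,
        Equiv.symm_apply_eq, Fin.cycleIcc_of_last h1]
    · rw [Equiv.Perm.mul_def, Equiv.symm_trans_apply, hq]
      have e : (Fin.cycleIcc p t).symm q = ⟨q.val - 1, by omega⟩ := by
        rw [Equiv.symm_apply_eq, Fin.cycleIcc_of_ge_of_lt]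
        · apply Fin.ext
          rw [Fin.val_add_one_of_lt']
          · simp only; omega
          · simp only; omega
        · rw [Fin.le_def]; simp only; omega
        · rw [Fin.lt_def]; simp only; omega
      rw [e]
      simp only
      omega
    · exfalso
      rw [Fin.le_def] at h1
      omega
    · rw [Equiv.Perm.mul_def, Equiv.symm_trans_apply, hq]
      have e : (Fin.cycleIcc p t).symm q = q := by
        rw [Equiv.symm_apply_eq]
        rw [Fin.le_def] at h1
        rw [Fin.ext_iff] at h2
        rcases lt_or_ge q p with h | h
        · rw [Fin.cycleIcc_of_lt h]
        · rw [Fin.cycleIcc_of_gt]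
          rw [Fin.lt_def]
          rw [Fin.le_def] at h
          omega
      rw [e]
    · rename_i h2
      have e : (π * (Fin.cycleIcc t p)⁻¹).symm w = Fin.cycleIcc t p q := by
        rw [Equiv.symm_apply_eq]
        change w = π ((Fin.cycleIcc t p).symm (Fin.cycleIcc t p q))
        rw [Equiv.symm_apply_apply, ← hq, Equiv.apply_symm_apply]
      rw [e, h2, Fin.cycleIcc_of_last (le_of_not_ge h1)]
    · exfalso
      rw [Fin.le_def] at h1
      omega
    · rename_i h2 h3 h4
      have e : (π * (Fin.cycleIcc t p)⁻¹).symm w = Fin.cycleIcc t p q := by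
        rw [Equiv.symm_apply_eq]
        change w = π ((Fin.cycleIcc t p).symm (Fin.cycleIcc t p q))
        rw [Equiv.symm_apply_apply, ← hq, Equiv.apply_symm_apply]
      rw [e, Fin.cycleIcc_of_ge_of_lt, Fin.val_add_one_of_lt']
      · push_cast; rfl
      · omega
      · rw [Fin.le_def]; omega
      · rw [Fin.lt_def]; omega
    · rename_i h2 h3 h4
      have e : (π * (Fin.cycleIcc t p)⁻¹).symm w = Fin.cycleIcc t p q := by
        rw [Equiv.symm_apply_eq]
        change w = π ((Fin.cycleIcc t p).symm (Fin.cycleIcc t p q))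
        rw [Equiv.symm_apply_apply, ← hq, Equiv.apply_symm_apply]
      rw [e]
      rw [Fin.le_def] at h1
      rw [Fin.ext_iff] at h2
      rcases lt_or_ge q t with h | h
      · rw [Fin.cycleIcc_of_lt h]
      · rw [Fin.cycleIcc_of_gt]
        rw [Fin.lt_def]
        rw [Fin.le_def] at h
        omega
  · rw [pos_of_not_mem _ hu, pos_of_not_mem _ hu, if_neg (by omega)]
    have := pos_mem π (u := v.val) (by omega) (by omega)
    simp only [shift]
    split_ifs <;> omega

/-- A displacement, described by positions. -/
structure IsDisp (v t : ℤ) (π π' : Equiv.Perm (Fin n)) : Prop where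
  nonneg : 0 ≤ v
  lt : v < n
  target_nonneg : 0 ≤ t
  target_lt : t < n
  ne : t ≠ v
  home : pos π v = v
  moved : pos π' v = t
  shifted : ∀ u, u ≠ v → pos π' u = shift v t (pos π u)

theorem displacement_iff {v t : Fin n} {π π' : Equiv.Perm (Fin n)} :
    Displacement v t π π' ↔ IsDisp v.val t.val π π' := by
  have hv := v.isLt
  have ht := t.isLt
  constructor
  · rintro ⟨h1, h2, rfl⟩
    have hh : pos π v.val = v.val := by rw [pos_coe, h1]
    refine ⟨by omega, by omega, by omega, by omega, ?_, hh, ?_, fun u hu => ?_⟩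
    · intro h
      exact h2 (Fin.ext (by omega))
    · rw [pos_moveTo, if_pos rfl]
    · rw [pos_moveTo, if_neg hu, hh]
  · intro h
    have h0 := h.home
    rw [pos_coe, Nat.cast_inj, Fin.val_inj] at h0
    refine ⟨h0, fun e => h.ne (by rw [e]), pos_ext fun u _ _ => ?_⟩
    rw [pos_moveTo, h.home]
    split_ifs with hu
    · rw [hu, h.moved]
    · exact h.shifted u hu

theorem IsDisp.exists {v t : ℤ} {π : Equiv.Perm (Fin n)} (h1 : 0 ≤ v) (h2 : v < n) (h3 : 0 ≤ t)
    (h4 : t < n) (h5 : t ≠ v) (h6 : pos π v = v) : ∃ π', IsDisp v t π π' := by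
  lift v to ℕ using h1
  lift t to ℕ using h3
  refine ⟨moveTo π ⟨v, by omega⟩ ⟨t, by omega⟩, ?_⟩
  refine (displacement_iff (v := ⟨v, by omega⟩) (t := ⟨t, by omega⟩)).1 ⟨?_, ?_, rfl⟩
  · have := pos_coe π ⟨v, by omega⟩
    simp only [h6] at this
    exact Fin.ext (by simp only; omega)
  · intro h
    rw [Fin.mk.injEq] at h
    omega

theorem IsDisp.unique {v t : ℤ} {π ρ ρ' : Equiv.Perm (Fin n)} (h : IsDisp v t π ρ)
    (h' : IsDisp v t π ρ') : ρ = ρ' := by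
  refine pos_ext fun u _ _ => ?_
  by_cases hu : u = v
  · rw [hu, h.moved, h'.moved]
  · rw [h.shifted u hu, h'.shifted u hu]

theorem placement_iff {π π' : Equiv.Perm (Fin n)} :
    Placement π π' ↔ ∃ v t, IsDisp v t π' π := by
  constructor
  · rintro ⟨v, hv, rfl⟩
    have hvl := v.isLt
    have hm := pos_mem π (u := v.val) (by omega) (by omega)
    refine ⟨v.val, pos π v.val, by omega, by omega, hm.1, hm.2, ?_, ?_, rfl, fun u hu => ?_⟩
    · rw [pos_coe]
      intro h
      exact hv (Fin.ext (by omega))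
    · rw [pos_moveTo, if_pos rfl]
    · have := (pos_injective π).ne hu
      rw [pos_moveTo, if_neg hu]
      simp only [shift]
      split_ifs <;> omega
  · rintro ⟨v, t, h⟩
    have h1 := h.nonneg
    have h2 := h.lt
    lift v to ℕ using h1
    obtain ⟨w, rfl⟩ : ∃ w : Fin n, w.val = v := ⟨⟨v, by omega⟩, rfl⟩
    refine ⟨w, fun hw => ?_, pos_ext fun u _ _ => ?_⟩
    · have := h.moved
      rw [pos_coe, hw] at this
      exact h.ne this.symm
    · rw [pos_moveTo, h.moved]
      split_ifs with hu
      · rw [hu, h.home]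
      · rw [h.shifted u hu]
        have := (pos_injective π').ne hu
        rw [h.home] at this
        simp only [shift]
        split_ifs <;> omega

/-! ### Signs -/

/-- The sign of the displacement of the entry `u` from its home. -/
def signWord (π : Equiv.Perm (Fin n)) (u : ℤ) : ℤ := Int.sign (pos π u - u)

theorem signWord_cases (π : Equiv.Perm (Fin n)) (u : ℤ) :
    (signWord π u = 1 ∧ u < pos π u) ∨ (signWord π u = 0 ∧ pos π u = u) ∨
      (signWord π u = -1 ∧ pos π u < u) := by
  rcases lt_trichotomy (pos π u) u with h | h | h
  · exact Or.inr (Or.inr ⟨Int.sign_eq_neg_one_of_neg (by omega), h⟩)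
  · exact Or.inr (Or.inl ⟨by simp [signWord, h], h⟩)
  · exact Or.inl ⟨Int.sign_eq_one_of_pos (by omega), h⟩

/-- `shift` split into linear cases, with the fact that position `v` is occupied by `v` itself; in
this form `omega` settles all later position arguments. -/
theorem IsDisp.pos_cases {v t : ℤ} {π π' : Equiv.Perm (Fin n)} (h : IsDisp v t π π') {u : ℤ}
    (hu : u ≠ v) : pos π u ≠ v ∧
      ((v < pos π u ∧ pos π u ≤ t ∧ pos π' u = pos π u - 1) ∨
      (t ≤ pos π u ∧ pos π u < v ∧ pos π' u = pos π u + 1) ∨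
      ((pos π u < v ∧ pos π u < t ∨ v < pos π u ∧ t < pos π u) ∧ pos π' u = pos π u)) := by
  have h1 := h.shifted u hu
  have h2 := (pos_injective π).ne hu
  rw [h.home] at h2
  simp only [shift] at h1
  split_ifs at h1 <;> omega

/-! ### Paths of displacements -/

/-- A displacement together with its result. -/
structure PermMove (n : ℕ) where
  value : ℤ
  target : ℤ
  next : Equiv.Perm (Fin n)

/-- A path of displacements. -/
def IsPath : Equiv.Perm (Fin n) → List (PermMove n) → Prop
  | _, [] => True
  | π, x :: l => IsDisp x.value x.target π x.next ∧ IsPath x.next l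

/-- The end of a path. -/
def pathEnd : Equiv.Perm (Fin n) → List (PermMove n) → Equiv.Perm (Fin n)
  | π, [] => π
  | _, x :: l => pathEnd x.next l

@[simp] theorem isPath_nil (π : Equiv.Perm (Fin n)) : IsPath π [] := trivial

@[simp] theorem isPath_cons {π : Equiv.Perm (Fin n)} {x : PermMove n} {l : List (PermMove n)} :
    IsPath π (x :: l) ↔ IsDisp x.value x.target π x.next ∧ IsPath x.next l := Iff.rfl

@[simp] theorem pathEnd_nil (π : Equiv.Perm (Fin n)) : pathEnd π [] = π := rfl

@[simp] theorem pathEnd_cons (π : Equiv.Perm (Fin n)) (x : PermMove n) (l : List (PermMove n)) :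
    pathEnd π (x :: l) = pathEnd x.next l := rfl

theorem isPath_append {π : Equiv.Perm (Fin n)} {l₁ l₂ : List (PermMove n)} :
    IsPath π (l₁ ++ l₂) ↔ IsPath π l₁ ∧ IsPath (pathEnd π l₁) l₂ := by
  induction l₁ generalizing π with
  | nil => simp
  | cons x l ih => simp [ih, and_assoc]

theorem pathEnd_append (π : Equiv.Perm (Fin n)) (l₁ l₂ : List (PermMove n)) :
    pathEnd π (l₁ ++ l₂) = pathEnd (pathEnd π l₁) l₂ := by
  induction l₁ generalizing π with
  | nil => simp
  | cons x l ih => simp [ih]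

/-- The effect of a displacement on the signs. -/
def PermMove.toSignMove (x : PermMove n) : SignMove :=
  ⟨x.value, Int.sign (x.target - x.value), signWord x.next⟩

/-- If `v` moves right, the entries passed lie beyond `v` and drop by one place. A value below `v`
stays to the right of its home, while a value above `v` lowers its sign by at most one. Left moves
are symmetric. -/
theorem IsPath.isRun {a : ℤ} {m : ℕ} {π : Equiv.Perm (Fin n)} {l : List (PermMove n)}
    (hl : IsPath π l) (h : ∀ x ∈ l, a ≤ x.value ∧ x.value < a + m) :
    IsRun a m (signWord π) (l.map PermMove.toSignMove) := by
  induction l generalizing π with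
  | nil => trivial
  | cons x l ih =>
    obtain ⟨hx, hl⟩ := hl
    refine ⟨?_, ih hl fun y hy => h y (by simp [hy])⟩
    have hm := h x (by simp)
    refine ⟨hm.1, hm.2, by simp [PermMove.toSignMove, signWord, hx.home],
      by simp [PermMove.toSignMove, signWord, hx.moved], ?_⟩
    simp only [PermMove.toSignMove]
    rcases lt_or_gt_of_ne hx.ne with hlt | hlt
    · refine Or.inr ⟨Int.sign_eq_neg_one_of_neg (by omega), fun u _ _ => ?_⟩
      rcases signWord_cases π u with h1 | h1 | h1 <;>
        rcases signWord_cases x.next u with h2 | h2 | h2 <;>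
        constructor <;> intro hu <;> have := hx.pos_cases (u := u) (by omega) <;> omega
    · refine Or.inl ⟨Int.sign_eq_one_of_pos (by omega), fun u _ _ => ?_⟩
      rcases signWord_cases π u with h1 | h1 | h1 <;>
        rcases signWord_cases x.next u with h2 | h2 | h2 <;>
        constructor <;> intro hu <;> have := hx.pos_cases (u := u) (by omega) <;> omega

theorem finalWord_map (π : Equiv.Perm (Fin n)) (l : List (PermMove n)) :
    finalWord (signWord π) (l.map PermMove.toSignMove) = signWord (pathEnd π l) := by
  induction l generalizing π with
  | nil => rfl
  | cons x l ih => exact ih _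

/-! ### Paths and steps -/

theorem Steps.trans {α : Type*} {R : α → α → Prop} {m k : ℕ} {a b c : α} (h : Steps R m a b)
    (h' : Steps R k b c) : Steps R (m + k) a c := by
  induction m generalizing a with
  | zero => obtain rfl : a = b := h; rwa [Nat.zero_add]
  | succ m ih =>
    obtain ⟨d, hd, h⟩ := h
    rw [Nat.succ_add]
    exact ⟨d, hd, ih h⟩

theorem Steps.reverse {α : Type*} {R S : α → α → Prop} (hRS : ∀ a b, R a b → S b a) {m : ℕ} {a b : α}
    (h : Steps R m a b) : Steps S m b a := by
  induction m generalizing a with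
  | zero => exact h.symm
  | succ m ih =>
    obtain ⟨d, hd, h⟩ := h
    exact (ih h).trans (k := 1) ⟨a, hRS _ _ hd, rfl⟩

theorem steps_disp_iff {m : ℕ} {π σ : Equiv.Perm (Fin n)} :
    Steps (fun π π' => ∃ v t, IsDisp v t π π') m π σ ↔
      ∃ l : List (PermMove n), l.length = m ∧ IsPath π l ∧ pathEnd π l = σ := by
  induction m generalizing π with
  | zero =>
    constructor
    · intro h; exact ⟨[], rfl, trivial, h⟩
    · rintro ⟨l, hl, -, h⟩
      obtain rfl := List.length_eq_zero_iff.1 hl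
      exact h
  | succ m ih =>
    constructor
    · rintro ⟨ρ, ⟨v, t, h⟩, hs⟩
      obtain ⟨l, hl, hp, he⟩ := ih.1 hs
      exact ⟨⟨v, t, ρ⟩ :: l, by simp [hl], ⟨h, hp⟩, he⟩
    · rintro ⟨l, hl, hp, he⟩
      match l, hl with
      | x :: l, hl =>
        exact ⟨x.next, ⟨_, _, hp.1⟩, ih.2 ⟨l, by simpa using hl, hp.2, he⟩⟩

theorem steps_placement_iff {m : ℕ} {σ : Equiv.Perm (Fin n)} :
    Steps Placement m σ 1 ↔
      ∃ l : List (PermMove n), l.length = m ∧ IsPath 1 l ∧ pathEnd 1 l = σ := by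
  rw [← steps_disp_iff]
  exact ⟨Steps.reverse fun _ _ h => placement_iff.1 h,
    Steps.reverse fun _ _ h => placement_iff.2 h⟩

/-! ### The upper bound -/

/-- All displacements of `l` take place within the interval `[a, b]`. -/
def Within (a b : ℤ) (l : List (PermMove n)) : Prop :=
  ∀ x ∈ l, (a ≤ x.value ∧ x.value ≤ b) ∧ a ≤ x.target ∧ x.target ≤ b

/-- To shift the entry `a` back to position `a`, a displacement would have to start or end beyond
the edge of the interval, or displace `a` itself, which is not at home. -/
theorem IsPath.away_left {a b : ℤ} {π : Equiv.Perm (Fin n)} {l : List (PermMove n)}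
    (hl : IsPath π l) (h : Within a b l) (ha : pos π a ≠ a) :
    pos (pathEnd π l) a ≠ a ∧ ∀ x ∈ l, a < x.value := by
  induction l generalizing π with
  | nil => simpa using ha
  | cons x l ih =>
    have hx := h x (by simp)
    have hne : a ≠ x.value := fun e => ha (by rw [e]; exact hl.1.home)
    have := hl.1.pos_cases hne
    have := ih hl.2 (fun y hy => h y (by simp [hy])) (by omega)
    refine ⟨this.1, fun y hy => ?_⟩
    rcases List.mem_cons.1 hy with rfl | hy
    exacts [by omega, this.2 y hy]

theorem IsPath.away_right {a b : ℤ} {π : Equiv.Perm (Fin n)} {l : List (PermMove n)}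
    (hl : IsPath π l) (h : Within a b l) (hb : pos π b ≠ b) :
    pos (pathEnd π l) b ≠ b ∧ ∀ x ∈ l, x.value < b := by
  induction l generalizing π with
  | nil => simpa using hb
  | cons x l ih =>
    have hx := h x (by simp)
    have hne : b ≠ x.value := fun e => hb (by rw [e]; exact hl.1.home)
    have := hl.1.pos_cases hne
    have := ih hl.2 (fun y hy => h y (by simp [hy])) (by omega)
    refine ⟨this.1, fun y hy => ?_⟩
    rcases List.mem_cons.1 hy with rfl | hy
    exacts [by omega, this.2 y hy]

/-- An end that leaves home does not return, so an end at home at the finish has never been touched,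
and the path lives in a shorter interval. -/
theorem IsPath.within_of_home_left {a b : ℤ} {π : Equiv.Perm (Fin n)} {l : List (PermMove n)}
    (hl : IsPath π l) (h : Within a b l) (ha : pos (pathEnd π l) a = a) :
    pos π a = a ∧ Within (a + 1) b l := by
  induction l generalizing π with
  | nil => exact ⟨ha, by simp [Within]⟩
  | cons x l ih =>
    have hx := h x (by simp)
    have := ih hl.2 (fun y hy => h y (by simp [hy])) ha
    have hmv := hl.1.moved
    have hne := hl.1.ne
    have hav : a ≠ x.value := fun e => by rw [← e] at hmv; omega
    have := hl.1.pos_cases hav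
    refine ⟨by omega, fun y hy => ?_⟩
    rcases List.mem_cons.1 hy with rfl | hy
    · omega
    · exact (ih hl.2 (fun y hy => h y (by simp [hy])) ha).2 y hy

theorem IsPath.within_of_home_right {a b : ℤ} {π : Equiv.Perm (Fin n)} {l : List (PermMove n)}
    (hl : IsPath π l) (h : Within a b l) (hb : pos (pathEnd π l) b = b) :
    pos π b = b ∧ Within a (b - 1) l := by
  induction l generalizing π with
  | nil => exact ⟨hb, by simp [Within]⟩
  | cons x l ih =>
    have hx := h x (by simp)
    have := ih hl.2 (fun y hy => h y (by simp [hy])) hb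
    have hmv := hl.1.moved
    have hne := hl.1.ne
    have hav : b ≠ x.value := fun e => by rw [← e] at hmv; omega
    have := hl.1.pos_cases hav
    refine ⟨by omega, fun y hy => ?_⟩
    rcases List.mem_cons.1 hy with rfl | hy
    · omega
    · exact (ih hl.2 (fun y hy => h y (by simp [hy])) hb).2 y hy

theorem exists_first_away (a b : ℤ) {π : Equiv.Perm (Fin n)} (h : pos π a = a ∨ pos π b = b)
    (l : List (PermMove n)) :
    (pos (pathEnd π l) a = a ∨ pos (pathEnd π l) b = b) ∨
      ∃ l₁ x l₂, l = l₁ ++ x :: l₂ ∧ (pos (pathEnd π l₁) a = a ∨ pos (pathEnd π l₁) b = b) ∧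
        pos x.next a ≠ a ∧ pos x.next b ≠ b := by
  induction l generalizing π with
  | nil => exact Or.inl h
  | cons x l ih =>
    by_cases hx : pos x.next a = a ∨ pos x.next b = b
    · rcases ih hx with h' | ⟨l₁, y, l₂, rfl, h1, h2⟩
      · exact Or.inl h'
      · exact Or.inr ⟨x :: l₁, y, l₂, rfl, h1, h2⟩
    · exact Or.inr ⟨[], x, l, rfl, h, by tauto, by tauto⟩

theorem IsPath.length_le_of_away {a : ℤ} {m : ℕ} {π : Equiv.Perm (Fin n)} {l : List (PermMove n)}
    (hl : IsPath π l) (h : Within a (a + m + 1) l)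
    (ha : pos π a ≠ a) (hb : pos π (a + m + 1) ≠ a + m + 1) :
    l.length + 1 ≤ 2 ^ m ∧
      (l.length + 1 = 2 ^ m → ∀ u, a < u → u < a + m + 1 → pos π u = u) := by
  have h1 := (hl.away_left h ha).2
  have h2 := (hl.away_right h hb).2
  have hr := runBound m (a + 1) _ _ (hl.isRun fun x hx => by
    have := h1 x hx
    have := h2 x hx
    omega)
  rw [List.length_map] at hr
  refine ⟨hr.1, fun he u hu hu' => ?_⟩
  have := hr.2 he u (by omega) (by omega)
  have := signWord_cases π u
  omega

/-- Cut at the first displacement after which both ends are away. The part before it fits in an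
interval shorter by one and is bounded by induction; the part after it is a run on the inner values.
-/
theorem IsPath.length_le {a : ℤ} {m : ℕ} {l : List (PermMove n)}
    (hl : IsPath (1 : Equiv.Perm (Fin n)) l) (h : Within a (a + m) l) : l.length + 1 ≤ 2 ^ m := by
  induction m generalizing a l with
  | zero =>
    cases l with
    | nil => simp
    | cons x l =>
      have := h x (by simp)
      have := hl.1.ne
      push_cast at *
      omega
  | succ m ih =>
    have key : ∀ l : List (PermMove n), IsPath 1 l → Within a (a + m + 1) l →
        (pos (pathEnd 1 l) a = a ∨ pos (pathEnd 1 l) (a + m + 1) = a + m + 1) →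
        l.length + 1 ≤ 2 ^ m := by
      intro l hl h hh
      rcases hh with hh | hh
      · refine ih (a := a + 1) hl ?_
        rw [show a + 1 + m = a + m + 1 by ring]
        exact (hl.within_of_home_left h hh).2
      · refine ih (a := a) hl ?_
        rw [show a + m = a + m + 1 - 1 by ring]
        exact (hl.within_of_home_right h hh).2
    have e1 : 2 ^ (m + 1) = 2 * 2 ^ m := by ring
    push_cast at h
    rw [← add_assoc] at h
    rcases exists_first_away a (a + m + 1) (Or.inl (pos_one (n := n) a)) l with
      h' | ⟨l₁, x, l₂, rfl, h1, h2, h3⟩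
    · have := key l hl h h'
      omega
    · obtain ⟨hl₁, hx, hl₂⟩ := isPath_append.1 hl
      have g1 := key l₁ hl₁ (fun y hy => h y (by simp [hy])) h1
      have g2 := (hl₂.length_le_of_away (fun y hy => h y (by simp [hy])) h2 h3).1
      simp only [List.length_append, List.length_cons]
      omega

/-- The equality case of the same cut: the second part must be a longest run, and such a run starts
with all its letters at home. -/
theorem IsPath.exists_middle {m : ℕ} {l : List (PermMove n)} {a : ℤ}
    (hl : IsPath (1 : Equiv.Perm (Fin n)) l) (h : Within a (a + m + 1) l)
    (hlen : l.length + 1 = 2 ^ (m + 1)) :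
    ∃ l₁ x l₂, l = l₁ ++ x :: l₂ ∧ l₂.length + 1 = 2 ^ m ∧ pos x.next a ≠ a ∧
      pos x.next (a + m + 1) ≠ a + m + 1 ∧ ∀ u, a < u → u < a + m + 1 → pos x.next u = u := by
  have key : ∀ l : List (PermMove n), IsPath 1 l → Within a (a + m + 1) l →
      (pos (pathEnd 1 l) a = a ∨ pos (pathEnd 1 l) (a + m + 1) = a + m + 1) →
      l.length + 1 ≤ 2 ^ m := by
    intro l hl h hh
    rcases hh with hh | hh
    · refine hl.length_le (a := a + 1) ?_
      rw [show a + 1 + m = a + m + 1 by ring]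
      exact (hl.within_of_home_left h hh).2
    · refine hl.length_le (a := a) ?_
      rw [show a + m = a + m + 1 - 1 by ring]
      exact (hl.within_of_home_right h hh).2
  have e1 : 2 ^ (m + 1) = 2 * 2 ^ m := by ring
  have : 0 < 2 ^ m := by positivity
  rcases exists_first_away a (a + m + 1) (Or.inl (pos_one (n := n) a)) l with
    h' | ⟨l₁, x, l₂, rfl, h1, h2, h3⟩
  · have := key l hl h h'
    omega
  · obtain ⟨hl₁, hx, hl₂⟩ := isPath_append.1 hl
    have g1 := key l₁ hl₁ (fun y hy => h y (by simp [hy])) h1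
    have g2 := hl₂.length_le_of_away (fun y hy => h y (by simp [hy])) h2 h3
    simp only [List.length_append, List.length_cons] at hlen
    exact ⟨l₁, x, l₂, rfl, by omega, h2, h3, g2.2 (by omega)⟩

theorem IsPath.within_univ {π : Equiv.Perm (Fin n)} {l : List (PermMove n)} (hl : IsPath π l) :
    Within 0 (n - 1) l := by
  induction l generalizing π with
  | nil => simp [Within]
  | cons x l ih =>
    intro y hy
    rcases List.mem_cons.1 hy with rfl | hy
    · have := hl.1.nonneg
      have := hl.1.lt
      have := hl.1.target_nonneg
      have := hl.1.target_lt
      omega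
    · exact ih hl.2 y hy

theorem IsPath.length_le_univ {l : List (PermMove n)} (hn : 1 ≤ n)
    (hl : IsPath (1 : Equiv.Perm (Fin n)) l) : l.length + 1 ≤ 2 ^ (n - 1) :=
  hl.length_le (a := 0) (by
    rw [show (0 : ℤ) + ((n - 1 : ℕ) : ℤ) = n - 1 by omega]
    exact hl.within_univ)

theorem mem_M_iff (hn : 1 ≤ n) {σ : Equiv.Perm (Fin n)} :
    σ ∈ M n ↔ ∃ l : List (PermMove n), l.length + 1 = 2 ^ (n - 1) ∧ IsPath 1 l ∧
      pathEnd 1 l = σ := by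
  have : 0 < 2 ^ (n - 1) := by positivity
  simp only [M, HasHeight, Set.mem_ofPred_eq, IsGreatest, steps_placement_iff]
  constructor
  · rintro ⟨⟨l, h1, h2⟩, -⟩
    exact ⟨l, by omega, h2⟩
  · rintro ⟨l, h1, h2⟩
    refine ⟨⟨l, by omega, h2⟩, ?_⟩
    rintro m ⟨l', h1, h2, h3⟩
    have := h2.length_le_univ hn
    omega

/-! ### Performing lists of displacements -/

theorem performs_cons {a b : ℕ} {l : List (ℕ × ℕ)} {π π' : Equiv.Perm (Fin n)} :
    Performs ((a, b) :: l) π π' ↔ ∃ ρ, IsDisp (a : ℤ) b π ρ ∧ Performs l ρ π' := by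
  constructor
  · rintro ⟨v, t, ρ, rfl, rfl, h, h'⟩
    exact ⟨ρ, displacement_iff.1 h, h'⟩
  · rintro ⟨ρ, h, h'⟩
    have h1 := h.lt
    have h2 := h.target_lt
    exact ⟨⟨a, by omega⟩, ⟨b, by omega⟩, ρ, rfl, rfl, displacement_iff.2 h, h'⟩

theorem performs_append {l₁ l₂ : List (ℕ × ℕ)} {π π' : Equiv.Perm (Fin n)} :
    Performs (l₁ ++ l₂) π π' ↔ ∃ ρ, Performs l₁ π ρ ∧ Performs l₂ ρ π' := by
  induction l₁ generalizing π with
  | nil => simp [Performs]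
  | cons x l ih =>
    obtain ⟨a, b⟩ := x
    simp only [List.cons_append, performs_cons, ih]
    constructor
    · rintro ⟨ρ, h, ρ', h1, h2⟩
      exact ⟨ρ', ⟨ρ, h, h1⟩, h2⟩
    · rintro ⟨ρ', ⟨ρ, h, h1⟩, h2⟩
      exact ⟨ρ, h, ρ', h1, h2⟩

theorem performs_singleton {a b : ℕ} {π π' : Equiv.Perm (Fin n)} :
    Performs [(a, b)] π π' ↔ IsDisp (a : ℤ) b π π' := by
  rw [performs_cons]
  simp [Performs]

theorem Performs.unique {l : List (ℕ × ℕ)} {π ρ ρ' : Equiv.Perm (Fin n)} (h : Performs l π ρ)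
    (h' : Performs l π ρ') : ρ = ρ' := by
  induction l generalizing π with
  | nil => exact Eq.trans (Eq.symm h) h'
  | cons x l ih =>
    obtain ⟨a, b⟩ := x
    obtain ⟨ρ₁, h1, h2⟩ := performs_cons.1 h
    obtain ⟨ρ₂, h3, h4⟩ := performs_cons.1 h'
    obtain rfl := h1.unique h3
    exact ih h2 h4

theorem Performs.exists_path {l : List (ℕ × ℕ)} {π π' : Equiv.Perm (Fin n)} (h : Performs l π π') :
    ∃ l' : List (PermMove n), l'.length = l.length ∧ IsPath π l' ∧ pathEnd π l' = π' := by
  induction l generalizing π with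
  | nil => exact ⟨[], rfl, trivial, h⟩
  | cons x l ih =>
    obtain ⟨a, b⟩ := x
    obtain ⟨ρ, h1, h2⟩ := performs_cons.1 h
    obtain ⟨l', h3, h4, h5⟩ := ih h2
    exact ⟨⟨a, b, ρ⟩ :: l', by simp [h3], ⟨h1, h4⟩, h5⟩

theorem length_leftPrefix (p k : ℕ) : (leftPrefix p (k + 1)).length + 1 = 2 ^ k := by
  induction k with
  | zero => rfl
  | succ k ih =>
    simp only [leftPrefix, List.length_append, List.length_cons, List.length_nil]
    omega

theorem length_rightPrefix (p k : ℕ) : (rightPrefix p (k + 1)).length + 1 = 2 ^ k := by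
  induction k with
  | zero => rfl
  | succ k ih =>
    simp only [rightPrefix, List.length_append, List.length_cons, List.length_nil]
    omega

/-- `leftPrefix p (k + 1)` moves the entry in position `p` over the fixed points
`p + 1, …, p + k`. -/
theorem exists_performs_leftPrefix {p k : ℕ} {π : Equiv.Perm (Fin n)} (hpk : p + k + 1 ≤ n)
    (hπ : ∀ u : ℤ, p < u → u < p + k + 1 → pos π u = u) :
    ∃ π', Performs (leftPrefix p (k + 1)) π π' ∧
      (∀ u : ℤ, p < u → u < p + k + 1 → pos π' u = u - 1) ∧
      ∀ u : ℤ, ¬ (p < u ∧ u < p + k + 1) →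
        (pos π u = p ∧ pos π' u = p + k) ∨ (pos π u ≠ p ∧ pos π' u = pos π u) := by
  induction k generalizing π with
  | zero => exact ⟨π, rfl, fun u _ _ => by omega, fun u _ => by omega⟩
  | succ k ih =>
    obtain ⟨π₁, h1, h2, h3⟩ := ih (by omega) fun u hu hu' => hπ u hu (by push_cast; omega)
    have ht := hπ (p + k + 1) (by omega) (by push_cast; omega)
    have ht1 := h3 (p + k + 1) (by omega)
    obtain ⟨π₂, hd⟩ := IsDisp.exists (v := p + k + 1) (t := p) (π := π₁) (by omega) (by omega)
      (by omega) (by omega) (by omega) (by omega)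
    -- The first pass left these entries one place too low; displacing `p + k + 1` into `p` pushes
    -- all of them up again, so that a second pass can carry the new entry of position `p` over
    -- them.
    have hl : ∀ u : ℤ, p < u → u < p + k + 1 → pos π₂ u = u := fun u hu hu' => by
      have := h2 u hu hu'
      have := hd.pos_cases (u := u) (by omega)
      omega
    have hdm := hd.moved
    obtain ⟨π₃, g1, g2, g3⟩ := ih (by omega) hl
    refine ⟨π₃, ?_, fun u hu hu' => ?_, fun u hu => ?_⟩
    · rw [leftPrefix, performs_append]
      refine ⟨π₂, performs_append.2 ⟨π₁, h1, performs_singleton.2 ?_⟩, g1⟩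
      push_cast
      rw [← add_assoc]
      exact hd
    · push_cast at hu'
      by_cases hut : u = p + k + 1
      · have := g3 u (by omega)
        rw [← hut] at hdm
        omega
      · exact g2 u hu (by omega)
    · push_cast at hu ⊢
      have k1 := h3 u (by omega)
      have k2 := g3 u (by omega)
      have k3 := hd.pos_cases (u := u) (by omega)
      -- These positions hold their own values, and `u` is not one of those.
      have k4 : ¬ (p < pos π u ∧ pos π u < p + k + 2) := fun h => by
        have := pos_injective π (hπ (pos π u) h.1 (by push_cast; omega))
        omega
      omega

/-! ### Block codes -/

/-- The entries are, in this order of values, `i + 1` entries to the right of their homes, `k`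
entries at home, and `j + 1` entries to the left of their homes. -/
structure Block (π : Equiv.Perm (Fin n)) (i k j : ℕ) : Prop where
  sum_eq : i + k + j + 2 = n
  right : ∀ u : ℤ, 0 ≤ u → u ≤ i → u < pos π u
  home : ∀ u : ℤ, i < u → u ≤ i + k → pos π u = u
  left : ∀ u : ℤ, i + k < u → u < n → pos π u < u

theorem code_eq (π : Equiv.Perm (Fin n)) (m : Fin (n - 2)) :
    (code π m = 1 ∧ (m.val + 1 : ℤ) < pos π (m.val + 1)) ∨
      (code π m = 0 ∧ pos π (m.val + 1) = m.val + 1) ∨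
      (code π m = -1 ∧ pos π (m.val + 1) < m.val + 1) := by
  have hm := m.isLt
  have h := pos_coe π ⟨m.val + 1, by omega⟩
  simp only [Nat.cast_add, Nat.cast_one] at h
  rw [h, code]
  split_ifs with h1 h2
  · exact Or.inl ⟨rfl, by omega⟩
  · exact Or.inr (Or.inr ⟨rfl, by omega⟩)
  · exact Or.inr (Or.inl ⟨rfl, by omega⟩)

theorem Block.hasBlockCode {π : Equiv.Perm (Fin n)} {i k j : ℕ} (h : Block π i k j) :
    HasBlockCode π i k j := by
  have hs := h.sum_eq
  refine ⟨by omega, fun m => ?_⟩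
  have hm := m.isLt
  have h1 := h.right (m.val + 1) (by omega)
  have h2 := h.home (m.val + 1)
  have h3 := h.left (m.val + 1)
  rcases code_eq π m with hc | hc | hc <;> rw [hc.1] <;> split_ifs <;> first | rfl | omega

/-- The code has no letter for the smallest and the largest value; if away from home, they can only
be to the right and to the left of it, respectively, and so extend the outer blocks. -/
theorem HasBlockCode.block {π : Equiv.Perm (Fin n)} {i k j : ℕ} (hn : 2 ≤ n)
    (h : HasBlockCode π i k j) (h0 : pos π 0 ≠ 0) (h1 : pos π (n - 1) ≠ n - 1) :
    Block π i k j := by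
  obtain ⟨hs, hc⟩ := h
  have b0 := pos_mem π (u := 0) (by omega) (by omega)
  have b1 := pos_mem π (u := n - 1) (by omega) (by omega)
  have key : ∀ u : ℤ, 1 ≤ u → u ≤ n - 2 → (u ≤ i → u < pos π u) ∧
      (i < u → u ≤ i + k → pos π u = u) ∧ (i + k < u → pos π u < u) := by
    intro u hu hu'
    obtain ⟨m, rfl⟩ : ∃ m : Fin (n - 2), (m.val + 1 : ℤ) = u :=
      ⟨⟨(u - 1).toNat, by omega⟩, by simp only; omega⟩
    have hm := hc m
    rcases code_eq π m with hc | hc | hc <;> rw [hc.1] at hm <;> split_ifs at hm <;>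
      omega
  refine ⟨by omega, fun u hu hu' => ?_, fun u hu hu' => ?_, fun u hu hu' => ?_⟩
  · by_cases h : u = 0
    · rw [h]; omega
    · exact (key u (by omega) (by omega)).1 hu'
  · exact (key u (by omega) (by omega)).2.1 hu hu'
  · by_cases h : u = n - 1
    · rw [h]; omega
    · exact (key u (by omega) (by omega)).2.2 hu

theorem Block.pos_ends_ne {π : Equiv.Perm (Fin n)} {i k j : ℕ} (h : Block π i k j) :
    pos π 0 ≠ 0 ∧ pos π (n - 1) ≠ n - 1 := by
  have := h.sum_eq
  have := h.right 0 le_rfl (by omega)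
  have := h.left (n - 1) (by omega) (by omega)
  omega

theorem Block.unique {π : Equiv.Perm (Fin n)} {i k j i' k' j' : ℕ} (h : Block π i k j)
    (h' : Block π i' k' j') (hk : 1 ≤ k) : i = i' ∧ k = k' ∧ j = j' := by
  have s1 := h.sum_eq
  have s2 := h'.sum_eq
  have a1 := h.home (i + 1) (by omega) (by omega)
  have a2 := h.home (i + k) (by omega) (by omega)
  have b1 := h'.right (i + 1) (by omega)
  have b2 := h'.left (i + 1)
  have b3 := h'.right (i + k) (by omega)
  have b4 := h'.left (i + k)
  have c1 := h'.home (i' + 1) (by omega) (by omega)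
  have c2 := h'.home (i' + k') (by omega) (by omega)
  have d1 := h.right (i' + 1) (by omega)
  have d2 := h.left (i' + 1)
  have d3 := h.right (i' + k') (by omega)
  have d4 := h.left (i' + k')
  omega

/-- The effect of a left firing. -/
theorem Block.leftFiring {π π' : Equiv.Perm (Fin n)} {i k j s : ℕ} (h : Block π i (k + 1) j)
    (hs : s ≤ i) (hp : Performs (leftPrefix i (k + 1) ++ [(i + (k + 1), s)]) π π') :
    Block π' i k (j + 1) := by
  obtain ⟨hsum, hr, hh, hl⟩ := h
  obtain ⟨ρ, hp1, hp2⟩ := performs_append.1 hp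
  obtain ⟨ρ', g1, g2, g3⟩ := exists_performs_leftPrefix (p := i) (k := k) (π := π) (by omega)
    fun u hu hu' => hh u hu (by push_cast; omega)
  obtain rfl := hp1.unique g1
  rw [performs_singleton] at hp2
  push_cast at hp2 hh hl
  -- The positions of the zero block are filled by the block itself, so an entry to the right of
  -- home jumps over the whole block or stays on one side of it.
  have g4 : ∀ u, pos π u = u ∨ ¬ (i < pos π u ∧ pos π u ≤ i + k + 1) := fun u => by
    by_contra! hc
    exact hc.1 (pos_injective π (hh _ hc.2.1 (by omega)))
  refine ⟨by omega, fun u hu hu' => ?_, fun u hu hu' => ?_, fun u hu hu' => ?_⟩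
  · have := hr u hu hu'
    have := g3 u (by omega)
    have := g4 u
    have := hp2.pos_cases (u := u) (by omega)
    omega
  · have := g2 u hu (by omega)
    have := hp2.pos_cases (u := u) (by omega)
    omega
  · by_cases hut : u = i + (k + 1)
    · have := hp2.moved
      rw [hut]
      omega
    · have := hl u (by omega) hu'
      have := g3 u (by omega)
      have := g4 u
      have := hp2.pos_cases (u := u) (by omega)
      omega

/-! ### Reflection of permutations -/

/-- The reflection of a permutation: conjugation by the reversal. -/
def reflect (π : Equiv.Perm (Fin n)) : Equiv.Perm (Fin n) := Fin.revPerm * π * Fin.revPerm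

theorem pos_reflect (π : Equiv.Perm (Fin n)) (u : ℤ) :
    pos (reflect π) u = n - 1 - pos π (n - 1 - u) := by
  by_cases hu : 0 ≤ u ∧ u < n
  · obtain ⟨h0, h1⟩ := hu
    lift u to ℕ using h0
    have e1 := pos_coe (reflect π) ⟨u, by omega⟩
    have e2 := pos_coe π (Fin.rev ⟨u, by omega⟩)
    have e3 : (reflect π).symm ⟨u, by omega⟩ = Fin.rev (π.symm (Fin.rev ⟨u, by omega⟩)) := by
      rw [Equiv.symm_apply_eq]
      simp [reflect]
    rw [e3, Fin.val_rev] at e1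
    rw [Fin.val_rev] at e2
    simp only at e1 e2
    rw [show (n - 1 - u : ℤ) = ((n - (u + 1) : ℕ) : ℤ) by omega, e1, e2]
    have := (π.symm (Fin.rev ⟨u, by omega⟩)).isLt
    omega
  · rw [pos_of_not_mem _ hu, pos_of_not_mem _ (by omega)]
    ring

theorem reflect_reflect (π : Equiv.Perm (Fin n)) : reflect (reflect π) = π := by
  refine pos_ext fun u _ _ => ?_
  rw [pos_reflect, pos_reflect]
  ring_nf

theorem IsDisp.reflect {v t : ℤ} {π π' : Equiv.Perm (Fin n)} (h : IsDisp v t π π') :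
    IsDisp (n - 1 - v) (n - 1 - t) (reflect π) (reflect π') := by
  obtain ⟨h1, h2, h3, h4, h5, h6, h7, h8⟩ := h
  refine ⟨by omega, by omega, by omega, by omega, by omega, ?_, ?_, fun u hu => ?_⟩
  · rw [pos_reflect, show (n - 1 - (n - 1 - v) : ℤ) = v by ring, h6]
  · rw [pos_reflect, show (n - 1 - (n - 1 - v) : ℤ) = v by ring, h7]
  · have := (pos_injective π).ne (a₁ := n - 1 - u) (a₂ := v) (by omega)
    rw [h6] at this
    rw [pos_reflect, pos_reflect, h8 _ (by omega)]
    simp only [shift]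
    split_ifs <;> omega

/-- The reflected displacement. -/
def reflectPair (n : ℕ) (x : ℕ × ℕ) : ℕ × ℕ := (n - 1 - x.1, n - 1 - x.2)

theorem Performs.reflect {l : List (ℕ × ℕ)} {π π' : Equiv.Perm (Fin n)} (h : Performs l π π') :
    Performs (l.map (reflectPair n)) (reflect π) (reflect π') := by
  induction l generalizing π with
  | nil => exact congrArg _ h
  | cons x l ih =>
    obtain ⟨a, b⟩ := x
    obtain ⟨ρ, h1, h2⟩ := performs_cons.1 h
    refine performs_cons.2 ⟨Homing.reflect ρ, ?_, ih h2⟩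
    have h3 := h1.lt
    have h4 := h1.target_lt
    have := h1.reflect
    simp only
    rw [show ((n - 1 - a : ℕ) : ℤ) = n - 1 - a by omega,
      show ((n - 1 - b : ℕ) : ℤ) = n - 1 - b by omega]
    exact this

theorem map_reflectPair_leftPrefix {p k : ℕ} (h : p + k ≤ n) :
    (leftPrefix p k).map (reflectPair n) = rightPrefix (n - 1 - p) k := by
  match k with
  | 0 => rfl
  | 1 => rfl
  | k + 2 =>
    rw [leftPrefix, rightPrefix, List.map_append, List.map_append,
      map_reflectPair_leftPrefix (k := k + 1) (by omega)]
    simp only [List.map_cons, List.map_nil, reflectPair]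
    rw [show n - 1 - (p + (k + 1)) = n - 1 - p - (k + 1) by omega]

theorem map_reflectPair_rightPrefix {p k : ℕ} (h : k ≤ p + 1) (hp : p + 1 ≤ n) :
    (rightPrefix p k).map (reflectPair n) = leftPrefix (n - 1 - p) k := by
  match k with
  | 0 => rfl
  | 1 => rfl
  | k + 2 =>
    rw [leftPrefix, rightPrefix, List.map_append, List.map_append,
      map_reflectPair_rightPrefix (k := k + 1) (by omega) hp]
    simp only [List.map_cons, List.map_nil, reflectPair]
    rw [show n - 1 - (p - (k + 1)) = n - 1 - p + (k + 1) by omega]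

theorem Block.reflect {π : Equiv.Perm (Fin n)} {i k j : ℕ} (h : Block π i k j) :
    Block (reflect π) j k i := by
  obtain ⟨hs, hr, hh, hl⟩ := h
  refine ⟨by omega, fun u hu hu' => ?_, fun u hu hu' => ?_, fun u hu hu' => ?_⟩ <;>
    rw [pos_reflect]
  · have := hl (n - 1 - u) (by omega) (by omega)
    omega
  · have := hh (n - 1 - u) (by omega) (by omega)
    omega
  · have := hr (n - 1 - u) (by omega) (by omega)
    omega

/-- The effect of a right firing. -/
theorem Block.rightFiring {π π' : Equiv.Perm (Fin n)} {i k j s : ℕ} (h : Block π i (k + 1) j)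
    (hs : i + (k + 1) + 1 ≤ s) (hsn : s < n)
    (hp : Performs (rightPrefix (i + (k + 1) + 1) (k + 1) ++ [(i + 1, s)]) π π') :
    Block π' (i + 1) k j := by
  have hsum := h.sum_eq
  have hr := hp.reflect
  rw [List.map_append, map_reflectPair_rightPrefix (by omega) (by omega)] at hr
  simp only [List.map_cons, List.map_nil, reflectPair] at hr
  rw [show n - 1 - (i + (k + 1) + 1) = j by omega,
    show n - 1 - (i + 1) = j + (k + 1) by omega] at hr
  have := (h.reflect.leftFiring (by omega) hr).reflect
  rwa [reflect_reflect] at this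

theorem Block.firing {π π' : Equiv.Perm (Fin n)} {i k j : ℕ} (h : Block π i k j)
    (hf : Firing π π') : ∃ k', k = k' + 1 ∧ (∃ i' j', Block π' i' k' j') ∧
      ∃ l : List (PermMove n), l.length = 2 ^ k' ∧ IsPath π l ∧ pathEnd π l = π' := by
  have hn : 2 ≤ n := by have := h.sum_eq; omega
  rcases hf with ⟨i₁, k₁, j₁, s, hk, hb, hs, hp⟩ | ⟨i₁, k₁, j₁, s, hk, hb, hs, hsn, hp⟩ <;>
    obtain ⟨rfl, rfl, rfl⟩ := (hb.block hn h.pos_ends_ne.1 h.pos_ends_ne.2).unique h hk <;>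
    obtain ⟨k, rfl⟩ : ∃ k, k₁ = k + 1 := ⟨k₁ - 1, by omega⟩ <;>
    refine ⟨k, rfl, ?_, ?_⟩
  · exact ⟨_, _, h.leftFiring hs hp⟩
  · obtain ⟨l, h1, h2⟩ := hp.exists_path
    refine ⟨l, ?_, h2⟩
    rw [h1, List.length_append, ← length_leftPrefix i₁ k]
    rfl
  · exact ⟨_, _, h.rightFiring hs hsn hp⟩
  · obtain ⟨l, h1, h2⟩ := hp.exists_path
    refine ⟨l, ?_, h2⟩
    rw [h1, List.length_append, ← length_rightPrefix (i₁ + (k + 1) + 1) k]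
    rfl

/-- Each firing removes one zero from the code, so the lengths are `2 ^ (k - 1), …, 2, 1`, with sum
`2 ^ k - 1`. -/
theorem Block.exists_path_of_steps {π σ : Equiv.Perm (Fin n)} {i k j : ℕ} (h : Block π i k j)
    (hf : Steps Firing k π σ) :
    ∃ l : List (PermMove n), l.length + 1 = 2 ^ k ∧ IsPath π l ∧ pathEnd π l = σ := by
  induction k generalizing π i j with
  | zero => exact ⟨[], rfl, trivial, hf⟩
  | succ k ih =>
    obtain ⟨ρ, hf, hs⟩ := hf
    obtain ⟨k', hk, ⟨i', j', hb⟩, l₁, h1, h2, h3⟩ := h.firing hf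
    obtain rfl : k = k' := by omega
    obtain ⟨l₂, g1, g2, g3⟩ := ih hb hs
    refine ⟨l₁ ++ l₂, ?_, isPath_append.2 ⟨h2, by rwa [h3]⟩, by rw [pathEnd_append, h3, g3]⟩
    rw [List.length_append, pow_succ]
    omega

/-! ### The permutation `tau` -/

theorem eq_tau (hn : 2 ≤ n) {π : Equiv.Perm (Fin n)}
    (h1 : pos π (n - 1) ≠ n - 1) (h : ∀ u : ℤ, 0 < u → u < n - 1 → pos π u = u) :
    π = tau n hn := by
  -- The inner positions are taken by their own values, so only the two end positions are left for
  -- the two end values.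
  have key : ∀ u : ℤ, 0 ≤ u → u < n → (pos π u = u ∨ pos π u = 0 ∨ pos π u = n - 1) := by
    intro u hu hu'
    have := pos_mem π hu hu'
    by_contra! hc
    exact hc.1 (pos_injective π (h (pos π u) (by omega) (by omega)))
  have k0 := key 0 (by omega) (by omega)
  have k1 := key (n - 1) (by omega) (by omega)
  have hi := (pos_injective π).ne (a₁ := 0) (a₂ := (n - 1 : ℤ)) (by omega)
  refine pos_ext fun u hu hu' => ?_
  lift u to ℕ using hu
  have e := pos_coe (tau n hn) ⟨u, by omega⟩
  simp only [tau, Equiv.symm_swap] at e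
  by_cases hu0 : u = 0
  · subst hu0
    rw [Equiv.swap_apply_left] at e
    rw [tau, e]
    simp only
    push_cast
    omega
  by_cases hu1 : u = n - 1
  · subst hu1
    rw [Equiv.swap_apply_right] at e
    rw [tau, e]
    simp only
    rw [show ((n - 1 : ℕ) : ℤ) = n - 1 by omega]
    push_cast
    omega
  · rw [Equiv.swap_apply_of_ne_of_ne (by simpa using hu0) (by simpa using hu1)] at e
    rw [tau, e]
    exact h u (by omega) (by omega)

/-- Displacing `m + 1` to the front of the rotation brings `1, …, m` home and pushes `0` to position
`m + 1`; `leftPrefix 0 (m + 1)` then carries `m + 1` over `1, …, m`, giving the next rotation. The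
lengths satisfy `2 ^ (m + 1) - 1 = 2 * (2 ^ m - 1) + 1`. -/
theorem exists_path_rotation {m : ℕ} (hm : m + 1 ≤ n) :
    ∃ (l : List (PermMove n)) (π : Equiv.Perm (Fin n)), l.length + 1 = 2 ^ m ∧ IsPath 1 l ∧
      pathEnd 1 l = π ∧ pos π 0 = m ∧ (∀ u : ℤ, 0 < u → u ≤ m → pos π u = u - 1) ∧
      ∀ u : ℤ, m < u → pos π u = u := by
  induction m with
  | zero => exact ⟨[], 1, rfl, trivial, rfl, pos_one _, fun u _ _ => by omega,
      fun u _ => pos_one u⟩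
  | succ m ih =>
    obtain ⟨l₁, π, h1, h2, h3, h4, h5, h6⟩ := ih (by omega)
    obtain ⟨ρ, hd⟩ := IsDisp.exists (v := m + 1) (t := 0) (π := π) (by omega) (by omega)
      (by omega) (by omega) (by omega) (h6 _ (by omega))
    have hdm := hd.moved
    obtain ⟨σ, g1, g2, g3⟩ := exists_performs_leftPrefix (p := 0) (k := m) (π := ρ) (by omega)
      fun u hu hu' => by
        simp only [Nat.cast_zero, zero_add] at hu hu'
        have := h5 u hu (by omega)
        have := hd.pos_cases (u := u) (by omega)
        omega
    simp only [Nat.cast_zero, zero_add] at g2 g3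
    obtain ⟨l₂, k1, k2, k3⟩ := g1.exists_path
    refine ⟨l₁ ++ ⟨m + 1, 0, ρ⟩ :: l₂, σ, ?_, ?_, ?_, ?_, fun u hu hu' => ?_, fun u hu => ?_⟩
    · have := length_leftPrefix 0 m
      simp only [List.length_append, List.length_cons, pow_succ]
      omega
    · exact isPath_append.2 ⟨h2, by rw [h3]; exact hd, k2⟩
    · rw [pathEnd_append, pathEnd_cons, k3]
    · have e0 := g3 0 (by omega)
      have e1 := hd.pos_cases (u := 0) (by omega)
      rw [h4] at e1
      push_cast
      omega
    · push_cast at hu'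
      by_cases hut : u = m + 1
      · have := g3 u (by omega)
        rw [← hut] at hdm
        omega
      · exact g2 u (by omega) (by omega)
    · push_cast at hu
      have := g3 u (by omega)
      have := h6 u (by omega)
      have := hd.pos_cases (u := u) (by omega)
      omega

theorem exists_path_tau (hn : 2 ≤ n) :
    ∃ l : List (PermMove n), l.length = 2 ^ (n - 2) ∧ IsPath 1 l ∧ pathEnd 1 l = tau n hn := by
  obtain ⟨l₁, π, h1, h2, h3, h4, h5, h6⟩ := exists_path_rotation (n := n) (m := n - 2) (by omega)
  obtain ⟨ρ, hd⟩ := IsDisp.exists (v := n - 1) (t := 0) (π := π) (by omega) (by omega)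
    (by omega) (by omega) (by omega) (h6 _ (by omega))
  refine ⟨l₁ ++ [⟨n - 1, 0, ρ⟩], by simpa using h1,
    isPath_append.2 ⟨h2, by rw [h3]; exact hd, trivial⟩, ?_⟩
  rw [pathEnd_append]
  refine eq_tau hn ?_ fun u hu hu' => ?_
  · have := hd.moved
    simp only [pathEnd_cons, pathEnd_nil]
    omega
  · have := hd.pos_cases (u := u) (by omega)
    have := h5 u hu (by omega)
    simp only [pathEnd_cons, pathEnd_nil]
    omega

theorem block_tau (hn : 2 ≤ n) : Block (tau n hn) 0 (n - 2) 0 := by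
  have key : ∀ u : ℤ, 0 ≤ u → u < n → pos (tau n hn) u =
      if u = 0 then (n - 1 : ℤ) else if u = n - 1 then 0 else u := by
    intro u hu hu'
    lift u to ℕ using hu
    have e := pos_coe (tau n hn) ⟨u, by omega⟩
    simp only at e
    rw [e, tau, Equiv.symm_swap, Equiv.swap_apply_def]
    simp only [Fin.mk.injEq]
    split_ifs <;> simp only <;> omega
  refine ⟨by omega, fun u hu hu' => ?_, fun u hu hu' => ?_, fun u hu hu' => ?_⟩ <;>
    rw [key u (by omega) (by omega)] <;> split_ifs <;> omega

/-! ### Longest paths consist of firings -/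

theorem IsRun.frozen_lefts {a : ℤ} {i m : ℕ} {s : ℤ → ℤ} {l : List SignMove}
    (hl : IsRun a (i + m) s l) (hs : ∀ u, a ≤ u → u < a + i → s u = 1) :
    IsRun (a + i) m s l := by
  induction i generalizing a with
  | zero => simpa using hl
  | succ i ih =>
    rw [show i + 1 + m = i + m + 1 by omega] at hl
    have := ih (hl.frozen_left (hs a le_rfl (by push_cast; omega))).1
      fun u hu hu' => hs u (by omega) (by push_cast; omega)
    rwa [add_assoc, add_comm (1 : ℤ), ← Nat.cast_succ] at this

theorem IsRun.frozen_rights {a : ℤ} {j m : ℕ} {s : ℤ → ℤ} {l : List SignMove}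
    (hl : IsRun a (m + j) s l) (hs : ∀ u, a + m ≤ u → u < a + (m + j) → s u = -1) :
    IsRun a m s l := by
  induction j with
  | zero => simpa using hl
  | succ j ih =>
    rw [← add_assoc] at hl
    exact ih (hl.frozen_right (hs _ (by push_cast; omega) (by push_cast; omega))).1
      fun u hu hu' => hs u hu (by push_cast; omega)

/-- Letters `+` at the left end and `-` at the right end are frozen one after the other, from the
outside inwards; only the zero block remains in play. -/
theorem Block.value_mem {π : Equiv.Perm (Fin n)} {i k j : ℕ} (h : Block π i k j)
    {l : List (PermMove n)} (hl : IsPath π l) : ∀ x ∈ l, i < x.value ∧ x.value ≤ i + k := by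
  have hs := h.sum_eq
  have hr : IsRun 0 ((i + 1) + k + (j + 1)) (signWord π) (l.map PermMove.toSignMove) :=
    hl.isRun fun x hx => by
      have := (hl.within_univ x hx).1
      push_cast
      omega
  have h1 := hr.frozen_rights fun u hu hu' => by
    have := h.left u (by push_cast at hu; omega) (by push_cast at hu'; omega)
    have := signWord_cases π u
    omega
  have h2 := h1.frozen_lefts fun u hu hu' => by
    have := h.right u (by omega) (by push_cast at hu'; omega)
    have := signWord_cases π u
    omega
  intro x hx
  have := h2.letter_mem _ (List.mem_map_of_mem hx)
  simp only [PermMove.toSignMove] at this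
  push_cast at this
  omega

theorem exists_split_of_map_eq {l : List (PermMove n)} {l₁ l₂ : List SignMove} {x : SignMove}
    (h : l.map PermMove.toSignMove = l₁ ++ x :: l₂) :
    ∃ k₁ y k₂, l = k₁ ++ y :: k₂ ∧ k₁.map PermMove.toSignMove = l₁ ∧ y.toSignMove = x ∧
      k₂.map PermMove.toSignMove = l₂ := by
  obtain ⟨k₁, k, rfl, h1, h2⟩ := List.map_eq_append_iff.1 h
  obtain ⟨y, k₂, rfl, h3, h4⟩ := List.map_eq_cons_iff.1 h2
  exact ⟨k₁, y, k₂, rfl, h1, h3, h4⟩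

theorem target_lt_of_dir {x : PermMove n} (h : x.toSignMove.dir = -1) : x.target < x.value := by
  have := Int.sign_eq_neg_one_iff_neg.1 h
  omega

theorem lt_target_of_dir {x : PermMove n} (h : x.toSignMove.dir = 1) : x.value < x.target := by
  have := Int.sign_eq_one_iff_pos.1 h
  omega

/-- A longest path of displacements to the left of the values `p + 1, …, p + k`, at the end of
which each of these values is one place to the left of its home, is given by `leftPrefix`. -/
theorem performs_leftPrefix_of_path {p k : ℕ} (hpk : p + k + 1 ≤ n) {π : Equiv.Perm (Fin n)}
    {l : List (PermMove n)} (hl : IsPath π l) (hlen : l.length + 1 = 2 ^ k)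
    (hv : ∀ x ∈ l, p < x.value ∧ x.value < p + k + 1 ∧ x.target < x.value)
    (h0 : ∀ u : ℤ, p < u → u < p + k + 1 → pos π u = u)
    (h1 : ∀ u : ℤ, p < u → u < p + k + 1 → pos (pathEnd π l) u = u - 1) :
    Performs (leftPrefix p (k + 1)) π (pathEnd π l) := by
  induction k generalizing π l with
  | zero =>
    obtain rfl : l = [] := List.length_eq_zero_iff.1 (by simpa using hlen)
    rfl
  | succ k ih =>
    have hr : IsRun (p + 1) (k + 1) (signWord π) (l.map PermMove.toSignMove) :=
      hl.isRun fun x hx => by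
        have := hv x hx
        push_cast at *
        omega
    obtain ⟨m₁, y, m₂, he, e1, e2, hc⟩ := hr.longest (by rwa [List.length_map])
    obtain ⟨l₁, x, l₂, rfl, rfl, rfl, rfl⟩ := exists_split_of_map_eq he
    rw [List.length_map] at e1 e2
    -- The alternative with a right move is excluded, since all displacements go to the left.
    rcases hc with ⟨-, hd, -⟩ | ⟨hxt, hd, hm, hs⟩
    · have := hv x (by simp)
      have := lt_target_of_dir hd
      omega
    obtain ⟨hl₁, hx, hl₂⟩ := isPath_append.1 hl
    rw [pathEnd_append, pathEnd_cons] at h1 ⊢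
    rw [finalWord_map] at hs
    rw [he] at hr
    simp only [PermMove.toSignMove] at hxt hs
    have htop : x.value = p + k + 1 := by omega
    have hr₂ := (isRun_append.1 hr).2.2.frozen_right (by
      simp only [PermMove.toSignMove]
      rw [← hxt, signWord, hx.moved]
      exact hd)
    -- The single displacement `x` brings `u` home from the left. It shifts entries by one place, so
    -- `u` was in position `u - 1`, and `x` reached at least that far.
    have hmid : ∀ u : ℤ, p < u → u < p + k + 1 →
        pos (pathEnd π l₁) u = u - 1 ∧ pos x.next u = u ∧ x.target ≤ u - 1 := by
      intro u hu hu'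
      have h2 := hs u (by omega) (by omega)
      have h3 := signWord_cases (pathEnd π l₁) u
      have h4 := signWord_cases x.next u
      have := hx.pos_cases (u := u) (by omega)
      have := hv x (by simp)
      omega
    have k1 := ih (by omega) hl₁ e1 (fun z hz => by
        have := hv z (by simp [hz])
        have := (hm _ (List.mem_map_of_mem hz)).2
        simp only [PermMove.toSignMove] at this
        push_cast at *
        omega) (fun u hu hu' => h0 u hu (by push_cast; omega)) fun u hu hu' => (hmid u hu hu').1
    have k2 := ih (by omega) hl₂ e2 (fun z hz => by
        have := hv z (by simp [hz])
        have := (hr₂.1.letter_mem _ (List.mem_map_of_mem hz)).2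
        simp only [PermMove.toSignMove] at this
        push_cast at *
        omega) (fun u hu hu' => (hmid u hu hu').2.1)
      fun u hu hu' => h1 u hu (by push_cast; omega)
    obtain ⟨ρ, g1, g2, g3⟩ := exists_performs_leftPrefix (p := p) (k := k) (π := x.next)
      (by omega) fun u hu hu' => (hmid u hu hu').2.1
    obtain rfl := k2.unique g1
    -- The second pass moves an entry outside the block only if it sits in position `p`, and then to
    -- `p + k`, which is where `p + k + 1` has to end. Any other target would remain its final
    -- position, but for `k ≥ 1` the target is at most `p`, and for `k = 0` the required position is
    -- `p` itself.
    have ht : x.target = p := by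
      have g := g3 (p + k + 1) (by omega)
      rw [← htop, hx.moved, htop] at g
      have := h1 (p + k + 1) (by omega) (by push_cast; omega)
      have := hmid (p + 1) (by omega)
      omega
    rw [leftPrefix, performs_append]
    refine ⟨x.next, performs_append.2 ⟨_, k1, performs_singleton.2 ?_⟩, k2⟩
    push_cast
    rw [← add_assoc, ← htop, ← ht]
    exact hx

/-- As the last displacement brings the other zeros home, they were exactly one place to the left,
which determines the preceding path. Its own target is only forced to be at most `i`: this is the
free parameter `s` of a firing. -/
theorem Block.leftFiring_of_path {π : Equiv.Perm (Fin n)} {i k j : ℕ} (h : Block π i (k + 1) j)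
    {l : List (PermMove n)} {x : PermMove n} (hl : IsPath π l)
    (hx : IsDisp x.value x.target (pathEnd π l) x.next) (hlen : l.length + 1 = 2 ^ k)
    (hv : ∀ y ∈ l, y.value < i + k + 1 ∧ y.target < y.value)
    (hxv : x.value = i + k + 1) (hxt : x.target < x.value)
    (hm : ∀ u : ℤ, i < u → u < i + k + 1 → pos (pathEnd π l) u < u ∧ pos x.next u = u) :
    LeftFiring π x.next := by
  have hs := h.sum_eq
  have hmid : ∀ u : ℤ, i < u → u < i + k + 1 →
      pos (pathEnd π l) u = u - 1 ∧ x.target ≤ u - 1 := by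
    intro u hu hu'
    have := hm u hu hu'
    have := hx.pos_cases (u := u) (by omega)
    omega
  have hp := performs_leftPrefix_of_path (p := i) (by omega) hl hlen
    (fun y hy => ⟨(h.value_mem hl y hy).1, hv y hy⟩)
    (fun u hu hu' => h.home u hu (by push_cast; omega)) fun u hu hu' => (hmid u hu hu').1
  have hti : x.target ≤ i := by
    have := hmid (i + 1) (by omega)
    omega
  have ht0 := hx.target_nonneg
  refine ⟨i, k + 1, j, x.target.toNat, by omega, h.hasBlockCode, by omega,
    performs_append.2 ⟨_, hp, performs_singleton.2 ?_⟩⟩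
  rw [Int.toNat_of_nonneg ht0]
  push_cast
  rw [← add_assoc, ← hxv]
  exact hx

/-- The reflected displacement. -/
def PermMove.reflect (x : PermMove n) : PermMove n :=
  ⟨n - 1 - x.value, n - 1 - x.target, Homing.reflect x.next⟩

theorem IsPath.reflect {π : Equiv.Perm (Fin n)} {l : List (PermMove n)} (hl : IsPath π l) :
    IsPath (reflect π) (l.map PermMove.reflect) := by
  induction l generalizing π with
  | nil => trivial
  | cons x l ih => exact ⟨hl.1.reflect, ih hl.2⟩

theorem pathEnd_reflect (π : Equiv.Perm (Fin n)) (l : List (PermMove n)) :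
    pathEnd (reflect π) (l.map PermMove.reflect) = reflect (pathEnd π l) := by
  induction l generalizing π with
  | nil => rfl
  | cons x l ih => exact ih _

theorem LeftFiring.reflect {π π' : Equiv.Perm (Fin n)} (h : LeftFiring π π')
    {i k j : ℕ} (hb : Block π i k j) (hk : 1 ≤ k) : RightFiring (reflect π) (reflect π') := by
  have hs := hb.sum_eq
  obtain ⟨i', k', j', s, hk', hb', hs', hp⟩ := h
  obtain ⟨rfl, rfl, rfl⟩ := hb.unique
    (hb'.block (by omega) hb.pos_ends_ne.1 hb.pos_ends_ne.2) hk
  refine ⟨j, k, i, n - 1 - s, hk, hb.reflect.hasBlockCode, by omega, by omega, ?_⟩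
  have hr := hp.reflect
  rw [List.map_append, map_reflectPair_leftPrefix (by omega)] at hr
  simp only [List.map_cons, List.map_nil, reflectPair] at hr
  rwa [show n - 1 - i = j + k + 1 by omega, show n - 1 - (i + k) = j + 1 by omega] at hr

theorem Block.exists_firing {π : Equiv.Perm (Fin n)} {i k j : ℕ} (h : Block π i (k + 1) j)
    {l : List (PermMove n)} (hl : IsPath π l) (hlen : l.length + 1 = 2 ^ (k + 1)) :
    ∃ l₁ x l₂, l = l₁ ++ x :: l₂ ∧ l₂.length + 1 = 2 ^ k ∧ Firing π x.next := by
  have hsum := h.sum_eq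
  have hmem := h.value_mem hl
  have hr : IsRun (i + 1) (k + 1) (signWord π) (l.map PermMove.toSignMove) :=
    hl.isRun fun x hx => by
      have := hmem x hx
      push_cast at *
      omega
  obtain ⟨m₁, y, m₂, he, e1, e2, hc⟩ := hr.longest (by rwa [List.length_map])
  obtain ⟨l₁, x, l₂, rfl, rfl, rfl, rfl⟩ := exists_split_of_map_eq he
  rw [List.length_map] at e1 e2
  refine ⟨l₁, x, l₂, rfl, e2, ?_⟩
  obtain ⟨hl₁, hx, hl₂⟩ := isPath_append.1 hl
  rw [finalWord_map] at hc
  rcases hc with ⟨hxt, hd, hm, hs⟩ | ⟨hxt, hd, hm, hs⟩ <;>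
    simp only [PermMove.toSignMove] at hxt hs
  -- If the first zero makes the extremal move, the reflected path ends in a left firing, and
  -- reflecting back gives a right firing.
  · right
    have hb := h.reflect
    have hlf := hb.leftFiring_of_path (l := l₁.map PermMove.reflect) (x := x.reflect)
      hl₁.reflect (by rw [pathEnd_reflect]; exact hx.reflect) (by rwa [List.length_map])
      (fun z hz => by
        obtain ⟨w, hw, rfl⟩ := List.mem_map.1 hz
        have hw' := hm _ (List.mem_map_of_mem hw)
        have := lt_target_of_dir hw'.1
        have := hmem w (by simp [hw])
        simp only [PermMove.toSignMove] at hw'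
        simp only [PermMove.reflect]
        omega)
      (by simp only [PermMove.reflect]; omega)
      (by have := lt_target_of_dir hd; simp only [PermMove.reflect]; omega)
      (fun u hu hu' => by
        rw [pathEnd_reflect]
        simp only [PermMove.reflect]
        rw [pos_reflect, pos_reflect]
        have := hs (n - 1 - u) (by omega) (by omega)
        have := signWord_cases (pathEnd π l₁) (n - 1 - u)
        have := signWord_cases x.next (n - 1 - u)
        omega)
    have := hlf.reflect hb (by omega)
    simp only [PermMove.reflect] at this
    rwa [reflect_reflect, reflect_reflect] at this
  · left
    refine h.leftFiring_of_path hl₁ hx e1 (fun z hz => ?_) (by omega) (target_lt_of_dir hd)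
      fun u hu hu' => ?_
    · have hz' := hm _ (List.mem_map_of_mem hz)
      have := target_lt_of_dir hz'.1
      have := hmem z (by simp [hz])
      simp only [PermMove.toSignMove] at hz'
      push_cast at this
      omega
    · have := hs u (by omega) (by omega)
      have := signWord_cases (pathEnd π l₁) u
      have := signWord_cases x.next u
      omega

theorem Block.steps_of_path {π : Equiv.Perm (Fin n)} {i k j : ℕ} (h : Block π i k j)
    {l : List (PermMove n)} (hl : IsPath π l) (hlen : l.length + 1 = 2 ^ k) :
    Steps Firing k π (pathEnd π l) := by
  induction k generalizing π i j l with
  | zero =>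
    obtain rfl : l = [] := List.length_eq_zero_iff.1 (by simpa using hlen)
    rfl
  | succ k ih =>
    obtain ⟨l₁, x, l₂, rfl, h2, hf⟩ := h.exists_firing hl hlen
    obtain ⟨k', hk, ⟨i', j', hb⟩, -⟩ := h.firing hf
    obtain rfl : k = k' := by omega
    rw [pathEnd_append]
    exact ⟨x.next, hf, ih hb (isPath_append.1 hl).2.2 h2⟩

end Homing

/-! ### The characterisation of the worst-case permutations -/

theorem lemma6p3 (n : ℕ) (hn : 2 ≤ n) (σ : Equiv.Perm (Fin n)) :
    σ ∈ Homing.M n ↔ Homing.Steps Homing.Firing (n - 2) (Homing.tau n hn) σ := by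
  have e : 2 ^ (n - 1) = 2 * 2 ^ (n - 2) := by
    rw [← pow_succ']
    congr 1
    omega
  rw [Homing.mem_M_iff (by omega)]
  constructor
  · rintro ⟨l, h1, h2, rfl⟩
    have h3 := h2.within_univ
    rw [show (n - 1 : ℤ) = 0 + ((n - 2 : ℕ) : ℤ) + 1 by omega] at h3
    -- The path is cut where both end values are first away from home; there it passes through
    -- `tau`.
    obtain ⟨l₁, x, l₂, rfl, g1, g2, g3, g4⟩ := h2.exists_middle h3 (by rw [pow_succ']; omega)
    have ht : x.next = Homing.tau n hn := by
      rw [show (0 + ((n - 2 : ℕ) : ℤ) + 1) = n - 1 by omega] at g3 g4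
      exact Homing.eq_tau hn g3 g4
    rw [Homing.pathEnd_append, Homing.pathEnd_cons, ← ht]
    have hb := Homing.block_tau hn
    rw [← ht] at hb
    exact hb.steps_of_path (Homing.isPath_append.1 h2).2.2 g1
  · intro h
    obtain ⟨l₁, h1, h2, h3⟩ := Homing.exists_path_tau hn
    obtain ⟨l₂, g1, g2, g3⟩ := (Homing.block_tau hn).exists_path_of_steps h
    refine ⟨l₁ ++ l₂, ?_, Homing.isPath_append.2 ⟨h2, by rwa [h3]⟩, ?_⟩
    · rw [List.length_append]
      omega
    · rw [Homing.pathEnd_append, h3, g3]
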